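/- **The first Chern class of the Wronskian line bundle.** Let $X$ be a connected Riemann surface and let $\mathcal V$ be a holomorphic vector bundle of rank $n\ge 1$ on $X$. A *projectively flat trivialization* of $\mathcal V$ is an open cover $\{U_i\}$ of $X$ by domains of holomorphic coordinates $z_i:U_i\to\mathbb C$, with holomorphic trivializations of $\mathcal V$ over the $U_i$ whose transition functions on $U_i\cap U_j$ are of the form $f_{ij}T_{ij}$ with $f_{ij}$ a nowhere zero holomorphic function and $T_{ij}\in GL_n(\mathbb C)$ a constant matrix. Two such are *compatible* if their trivializations differ, locally on the overlaps, by a nowhere zero holomorphic function times a constant invertible matrix. Let $\mathcal V$ be *projectively flat*, i.e. equipped with a projectively flat trivialization. In a projectively flat trivialization, a meromorphic section $A$ of $\mathcal V$ is given on $U_i$ by a meromorphic function $A_i=(a_1,\dots,a_n)$ of the coordinate $z_i$ with values in $\mathbb C^n$; let $w(A_i)=\det\big(a_c^{(r)}\big)_{0\le r<n,\,1\le c\le n}$ be its Wronskian determinant with respect to $z_i$. The section $A$ is *generic* if its Wronskian is not identically zero, and then $\operatorname{div}(A)$ denotes the divisor on $X$ that is given on $U_i$ by the divisor of $w(A_i)$.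 The *Wronskian line bundle* $w(\mathcal V)$ is the holomorphic line bundle corresponding to the divisor class of $\operatorname{div}(B)$, for any generic meromorphic section $B$ of $\mathcal V$; that is, $w(\mathcal V)$ has a meromorphic section with divisor $\operatorname{div}(B)$. For a holomorphic line bundle $L$ that is trivialized over each set of an open cover $\mathcal U$, with transition functions $g_{ij}$ (so that $s_i=g_{ij}s_j$ for the local expressions of a section $s$), $c_1(L)\in\check H^1(\mathcal U,\Omega^1)$ denotes the class of the Čech cocycle $\{d\log g_{ij}\}$. Let $A$ be a generic meromorphic section of $\mathcal V$, and let $\mathcal U=\{U_i\}$ be a projectively flat trivialization, compatible with the given one, such that $w(A_i)$ has no zeros or poles on $U_i\cap U_j$ for $i\ne j$. Then: 1. The Wronskian line bundle $w(\mathcal V)$ exists. 2. For each $i$ there are meromorphic functions $p_1^i,\dots,p_n^i$ on $U_i$ such that $$A_i^{(n)}=p_1^iA_i^{(n-1)}+p_2^iA_i^{(n-2)}+\cdots+p_n^iA_i ,$$ where the derivatives are taken with respect to $z_i$. 3. The quotients $\lambda_{ij}=w(A_i)/w(A_j)$ are (after removal of singularities) nowhere zero holomorphic functions on $U_i\cap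 U_j$, they satisfy $\lambda_{ij}\lambda_{jk}=\lambda_{ik}$ on $U_i\cap U_j\cap U_k$, and $w(\mathcal V)$ has trivializations over the sets $U_i$ with transition functions $\lambda_{ij}$. 4. For all $p_k^i$ as in 2, $d\log\lambda_{ij}=p_1^i\,dz_i-p_1^j\,dz_j$ on $U_i\cap U_j$. Hence $\{p_1^i\,dz_i-p_1^j\,dz_j\}$ is a Čech $1$-cocycle of $\mathcal U$ with values in the sheaf $\Omega^1$ of holomorphic $1$-forms, and it represents the first Chern class of $w(\mathcal V)$, which does not depend on the trivializations of $w(\mathcal V)$ over the sets $U_i$: $$c_1(w(\mathcal V))=[\{p_1^i\,dz_i-p_1^j\,dz_j\}]\in\check H^1(\mathcal U,\Omega^1).$$ -/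

import Mathlib

open scoped Manifold ContDiff Bundle Topology Matrix
open TopologicalSpace Bundle

universe u v w y

namespace Wronskian

/-! ### Holomorphic functions, one-forms and the Cech complex -/

section Forms

variable {X : Type u} [TopologicalSpace X] [ChartedSpace ℂ X]

/-- `f` is holomorphic on the subset `S` of the Riemann surface `X`. -/
def HolOn (f : X → ℂ) (S : Set X) : Prop := ContMDiffOn 𝓘(ℂ) 𝓘(ℂ) ω f S

/-- The (holomorphic) cotangent space of `X` at `x`: the dual of the tangent space. -/
def Cotangent (x : X) : Type := TangentSpace 𝓘(ℂ) x →L[ℂ] ℂ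

noncomputable instance (x : X) : AddCommGroup (Cotangent x) :=
  inferInstanceAs (AddCommGroup (TangentSpace 𝓘(ℂ) x →L[ℂ] ℂ))

noncomputable instance (x : X) : Module ℂ (Cotangent x) :=
  inferInstanceAs (Module ℂ (TangentSpace 𝓘(ℂ) x →L[ℂ] ℂ))

/-- The differential of a function at a point, as an element of the cotangent space. -/
noncomputable def diff (f : X → ℂ) (x : X) : Cotangent x :=
  mfderiv 𝓘(ℂ) 𝓘(ℂ) f x

/-- The logarithmic differential `d log f = f⁻¹ df`. -/
noncomputable def dlog (f : X → ℂ) (x : X) : Cotangent x :=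
  (f x)⁻¹ • diff f x

/-- The value at `x` of the one-form `p(z) dz`, for a coordinate `z = φ` and a function `p` of the
coordinate. -/
noncomputable def coordForm (φ : OpenPartialHomeomorph X ℂ) (p : ℂ → ℂ) (x : X) :
    Cotangent x :=
  p (φ x) • diff φ x

/-- All families of cotangent vectors on an open set. -/
abbrev Covectors (W : Opens X) : Type u := (x : W) → Cotangent (x : X)

/-- `Ω¹(W)`: the holomorphic one-forms on `W`, those which in each coordinate `z` of `X` are
`f dz` with `f` holomorphic. -/
noncomputable def Omega (W : Opens X) : Submodule ℂ (Covectors W) where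
  carrier := {η | ∀ φ ∈ IsManifold.maximalAtlas 𝓘(ℂ) ω X, ∃ f : X → ℂ,
    HolOn f (W ∩ φ.source) ∧ ∀ x : W, (x : X) ∈ φ.source → η x = f x • diff φ x}
  add_mem' := by
    intro a b ha hb φ hφ
    obtain ⟨f, hf, hf'⟩ := ha φ hφ
    obtain ⟨g, hg, hg'⟩ := hb φ hφ
    refine ⟨f + g, ContMDiffOn.add hf hg, fun x hx => ?_⟩
    rw [Pi.add_apply, hf' x hx, hg' x hx, Pi.add_apply, add_smul]
  zero_mem' := by
    intro φ _
    refine ⟨fun _ => 0, contMDiffOn_const, fun x _ => ?_⟩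
    rw [zero_smul]; rfl
  smul_mem' := by
    intro c a ha φ hφ
    obtain ⟨f, hf, hf'⟩ := ha φ hφ
    refine ⟨fun x => c * f x, ContMDiffOn.mul contMDiffOn_const hf, fun x hx => ?_⟩
    rw [Pi.smul_apply, hf' x hx, smul_smul]

/-- Restriction of holomorphic one-forms to a smaller open set. -/
noncomputable def restrict {W W' : Opens X} (h : W' ≤ W) : Omega W →ₗ[ℂ] Omega W' where
  toFun η := ⟨fun x => η.1 ⟨x, h x.2⟩, fun φ hφ => by
    obtain ⟨f, hf, hf'⟩ := η.2 φ hφ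
    exact ⟨f, hf.mono (Set.inter_subset_inter_left _ h), fun x hx => hf' ⟨x, h x.2⟩ hx⟩⟩
  map_add' _ _ := rfl
  map_smul' _ _ := rfl

variable {ι : Type w} (U : ι → Opens X)

/-- Cech `0`-cochains with coefficients in `Ω¹`. -/
def C0 : Type (max u w) := (i : ι) → Omega (U i)

noncomputable instance : AddCommGroup (C0 U) :=
  inferInstanceAs (AddCommGroup ((i : ι) → Omega (U i)))

noncomputable instance : Module ℂ (C0 U) :=
  inferInstanceAs (Module ℂ ((i : ι) → Omega (U i)))

/-- Cech `1`-cochains with coefficients in `Ω¹`. -/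
def C1 : Type (max u w) := (i j : ι) → Omega (U i ⊓ U j)

noncomputable instance : AddCommGroup (C1 U) :=
  inferInstanceAs (AddCommGroup ((i j : ι) → Omega (U i ⊓ U j)))

noncomputable instance : Module ℂ (C1 U) :=
  inferInstanceAs (Module ℂ ((i j : ι) → Omega (U i ⊓ U j)))

/-- Cech `2`-cochains with coefficients in `Ω¹`. -/
def C2 : Type (max u w) := (i j k : ι) → Omega (U i ⊓ U j ⊓ U k)

noncomputable instance : AddCommGroup (C2 U) :=
  inferInstanceAs (AddCommGroup ((i j k : ι) → Omega (U i ⊓ U j ⊓ U k)))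

noncomputable instance : Module ℂ (C2 U) :=
  inferInstanceAs (Module ℂ ((i j k : ι) → Omega (U i ⊓ U j ⊓ U k)))

/-- The Cech differential `(δη)_ij = η_j - η_i`. -/
noncomputable def d0 : C0 U →ₗ[ℂ] C1 U where
  toFun η i j := restrict inf_le_right (η j) - restrict inf_le_left (η i)
  map_add' a b := by
    funext i j
    show restrict inf_le_right (a j + b j) - restrict inf_le_left (a i + b i) =
      (restrict inf_le_right (a j) - restrict inf_le_left (a i)) +
      (restrict inf_le_right (b j) - restrict inf_le_left (b i))
    rw [map_add, map_add]
    abel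
  map_smul' c a := by
    funext i j
    show restrict inf_le_right (c • a j) - restrict inf_le_left (c • a i) =
      c • (restrict inf_le_right (a j) - restrict inf_le_left (a i))
    rw [map_smul, map_smul, smul_sub]

/-- The Cech differential `(δη)_ijk = η_jk - η_ik + η_ij`. -/
noncomputable def d1 : C1 U →ₗ[ℂ] C2 U where
  toFun η i j k :=
    restrict (le_inf (inf_le_left.trans inf_le_right) inf_le_right) (η j k)
      - restrict (le_inf (inf_le_left.trans inf_le_left) inf_le_right) (η i k)
      + restrict inf_le_left (η i j)
  map_add' a b := by
    funext i j k
    apply Subtype.ext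
    funext x
    show (a j k + b j k).1 ⟨x, _⟩ - (a i k + b i k).1 ⟨x, _⟩ + (a i j + b i j).1 ⟨x, _⟩ =
      ((a j k).1 ⟨x, _⟩ - (a i k).1 ⟨x, _⟩ + (a i j).1 ⟨x, _⟩) +
      ((b j k).1 ⟨x, _⟩ - (b i k).1 ⟨x, _⟩ + (b i j).1 ⟨x, _⟩)
    simp only [Submodule.coe_add, Pi.add_apply]
    abel
  map_smul' c a := by
    funext i j k
    apply Subtype.ext
    funext x
    show c • (a j k).1 ⟨x, _⟩ - c • (a i k).1 ⟨x, _⟩ + c • (a i j).1 ⟨x, _⟩ =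
      c • ((a j k).1 ⟨x, _⟩ - (a i k).1 ⟨x, _⟩ + (a i j).1 ⟨x, _⟩)
    rw [smul_add, smul_sub]

theorem d1_d0 (η : C0 U) : d1 U (d0 U η) = 0 := by
  funext i j k
  apply Subtype.ext
  funext x
  show ((η k).1 ⟨x, _⟩ - (η j).1 ⟨x, _⟩) - ((η k).1 ⟨x, _⟩ - (η i).1 ⟨x, _⟩) +
    ((η j).1 ⟨x, _⟩ - (η i).1 ⟨x, _⟩) = 0
  abel

/-- Cech `1`-cocycles with coefficients in `Ω¹`. -/
noncomputable abbrev Z1 : Submodule ℂ (C1 U) := LinearMap.ker (d1 U)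

/-- The Cech cohomology group `Ȟ¹(𝒰, Ω¹)`: cocycles modulo coboundaries. -/
abbrev H1 : Type (max u w) := Z1 U ⧸ (LinearMap.range (d0 U)).submoduleOf (Z1 U)

/-- The class in `Ȟ¹(𝒰, Ω¹)` of a cocycle. -/
noncomputable def cls (c : Z1 U) : H1 U := Submodule.Quotient.mk c

/-! Auxiliary facts: `d log` of a nowhere zero holomorphic function is a holomorphic one-form, and
`d log` turns products into sums. -/

theorem HolOn.mdifferentiableAt {f : X → ℂ} {W : Opens X} (hf : HolOn f W) {x : X} (hx : x ∈ W) :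
    MDifferentiableAt 𝓘(ℂ) 𝓘(ℂ) f x :=
  ((hf x hx).contMDiffAt (W.isOpen.mem_nhds hx)).mdifferentiableAt (by simp)

theorem dlog_mul {f g : X → ℂ} {x : X} (hf : MDifferentiableAt 𝓘(ℂ) 𝓘(ℂ) f x)
    (hg : MDifferentiableAt 𝓘(ℂ) 𝓘(ℂ) g x) (hf0 : f x ≠ 0) (hg0 : g x ≠ 0) :
    dlog (fun y => f y * g y) x = dlog f x + dlog g x := by
  have h : diff (fun y => f y * g y) x = f x • diff g x + g x • diff f x :=
    (hf.hasMFDerivAt.mul hg.hasMFDerivAt).mfderiv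
  rw [dlog, h, dlog, dlog, smul_add, smul_smul, smul_smul, add_comm]
  congr 2
  · field_simp
  · field_simp

theorem dlog_congr {f g : X → ℂ} {x : X} (h : f =ᶠ[𝓝 x] g) : dlog f x = dlog g x := by
  rw [dlog, dlog, diff, diff, h.mfderiv_eq, h.eq_of_nhds]

theorem dlog_mem_Omega {g : X → ℂ} {W : Opens X} (hg : HolOn g W) (hg0 : ∀ x ∈ W, g x ≠ 0) :
    (fun x : W => dlog g x) ∈ Omega W := by
  intro φ hφ
  have hopen : IsOpen (φ.target ∩ φ.symm ⁻¹' W) := φ.isOpen_inter_preimage_symm W.isOpen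
  have hG : ContDiffOn ℂ ω (g ∘ φ.symm) (φ.target ∩ φ.symm ⁻¹' W) := by
    rw [← contMDiffOn_iff_contDiffOn]
    refine ContMDiffOn.comp hg ((contMDiffOn_symm_of_mem_maximalAtlas hφ).mono
      Set.inter_subset_left) fun z hz => hz.2
  have hG' : ContDiffOn ℂ ω (deriv (g ∘ φ.symm)) (φ.target ∩ φ.symm ⁻¹' W) :=
    hG.deriv_of_isOpen hopen (by simp)
  have hmaps : ∀ x ∈ (W : Set X) ∩ φ.source, φ x ∈ φ.target ∩ φ.symm ⁻¹' W := by
    intro x hx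
    refine ⟨φ.map_source hx.2, ?_⟩
    rw [Set.mem_preimage, φ.left_inv hx.2]
    exact hx.1
  refine ⟨fun x => (g x)⁻¹ * deriv (g ∘ φ.symm) (φ x), ?_, ?_⟩
  · refine ContMDiffOn.mul ?_ ?_
    · intro x hx
      exact ContMDiffWithinAt.inv₀ (hg.mono Set.inter_subset_left x hx) (hg0 x hx.1)
    · exact ContMDiffOn.comp (contMDiffOn_iff_contDiffOn.2 hG')
        ((contMDiffOn_of_mem_maximalAtlas hφ).mono Set.inter_subset_right) hmaps
  · intro x hx
    have hx' := hmaps x ⟨x.2, hx⟩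
    have h1 : MDifferentiableAt 𝓘(ℂ) 𝓘(ℂ) φ (x : X) :=
      ((contMDiffOn_of_mem_maximalAtlas hφ x hx).contMDiffAt
        (φ.open_source.mem_nhds hx)).mdifferentiableAt (by simp)
    have h2 : DifferentiableAt ℂ (g ∘ φ.symm) (φ x) :=
      ((hG _ hx').contDiffAt (hopen.mem_nhds hx')).differentiableAt (by simp)
    have h3 : (g : X → ℂ) =ᶠ[𝓝 (x : X)] (g ∘ φ.symm) ∘ φ := by
      filter_upwards [φ.open_source.mem_nhds hx] with y hy
      simp [φ.left_inv hy]
    have h4 : diff g x = deriv (g ∘ φ.symm) (φ x) • diff φ (x : X) := by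
      rw [diff, h3.mfderiv_eq, mfderiv_comp (I' := 𝓘(ℂ)) (x : X) h2.mdifferentiableAt h1]
      refine ContinuousLinearMap.ext (M₁ := TangentSpace 𝓘(ℂ) (x : X)) fun v => ?_
      rw [mfderiv_eq_fderiv]
      exact (fderiv_eq_smul_deriv (𝕜 := ℂ) (f := g ∘ φ.symm) _).trans (mul_comm _ _)
    show dlog g x = _
    rw [dlog, h4, smul_smul]

end Forms

/-! ### Holomorphic vector bundles, frames and meromorphic sections -/

section Bundles

variable {X : Type u} [TopologicalSpace X] [ChartedSpace ℂ X]
  {F : Type*} [NormedAddCommGroup F] [NormedSpace ℂ F]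
  {E : X → Type v} [TopologicalSpace (TotalSpace F E)] [∀ x, TopologicalSpace (E x)]
  [∀ x, AddCommGroup (E x)] [∀ x, Module ℂ (E x)] [FiberBundle F E]

variable (F E) in
/-- A holomorphic trivialization over the open set `W` of a vector bundle `E` with typical fibre
`F`: fibrewise linear and biholomorphic. -/
structure HolTriv (W : Opens X) where
  /-- The underlying topological trivialization. -/
  triv : Trivialization F (π F E)
  baseSet_eq : triv.baseSet = W
  linear : triv.IsLinear ℂ
  hol : ContMDiffOn (𝓘(ℂ).prod 𝓘(ℂ, F)) (𝓘(ℂ).prod 𝓘(ℂ, F)) ω triv triv.source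
  hol_symm : ContMDiffOn (𝓘(ℂ).prod 𝓘(ℂ, F)) (𝓘(ℂ).prod 𝓘(ℂ, F)) ω
    triv.toOpenPartialHomeomorph.symm triv.target

/-- The expression `z ↦ (σ in the trivialization e)(φ⁻¹ z)` of a section in a coordinate and a
trivialization, as a function of the coordinate. -/
noncomputable def localRep (e : Trivialization F (π F E)) (φ : OpenPartialHomeomorph X ℂ)
    (σ : (x : X) → E x) (z : ℂ) : F :=
  (e ⟨φ.symm z, σ (φ.symm z)⟩).2

/-- The expression of a section near `x`, in the preferred coordinate and trivialization there. -/
noncomputable def localRepAt (x : X) (σ : (x : X) → E x) : ℂ → F :=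
  localRep (trivializationAt F E x) (chartAt ℂ x) σ

variable (F) in
/-- `σ` is a meromorphic section. As for meromorphic functions in Mathlib, a section is given by its
values at all points, and the values on a discrete set carry no information. -/
def IsMeromorphicSection (σ : (x : X) → E x) : Prop :=
  ∀ x, MeromorphicAt (localRepAt (F := F) x σ) (chartAt ℂ x x)

variable (F) in
/-- The order of vanishing at `x` of a meromorphic section (`⊤` if it vanishes near `x`). -/
noncomputable def sectionOrder (σ : (x : X) → E x) (x : X) : WithTop ℤ :=
  meromorphicOrderAt (localRepAt (F := F) x σ) (chartAt ℂ x x)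

end Bundles

/-! ### Holomorphic line bundles and the first Chern class -/

section Line

variable (X : Type u) [TopologicalSpace X] [ChartedSpace ℂ X]

/-- A holomorphic line bundle on `X`. -/
structure HolLineBundle where
  /-- The fibres. -/
  fiber : X → Type v
  [topTotal : TopologicalSpace (TotalSpace ℂ fiber)]
  [topFiber : ∀ x, TopologicalSpace (fiber x)]
  [addFiber : ∀ x, AddCommGroup (fiber x)]
  [modFiber : ∀ x, Module ℂ (fiber x)]
  [fiberBundle : FiberBundle ℂ fiber]
  [vectorBundle : VectorBundle ℂ ℂ fiber]
  [holomorphic : ContMDiffVectorBundle ω ℂ fiber 𝓘(ℂ)]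

attribute [instance] HolLineBundle.topTotal HolLineBundle.topFiber HolLineBundle.addFiber
  HolLineBundle.modFiber HolLineBundle.fiberBundle HolLineBundle.vectorBundle
  HolLineBundle.holomorphic

variable {X} {ι : Type w} {U : ι → Opens X} (L : HolLineBundle.{u, v} X)

/-- A holomorphic trivialization of `L` over each set of a family of open sets. -/
abbrev LineTriv (U : ι → Opens X) : Type _ := (i : ι) → HolTriv ℂ L.fiber (U i)

variable {L}

/-- The transition function `g_ij` of `L` on `U_i ∩ U_j`: if `s_i`, `s_j` are the expressions of a
section in the two trivializations, then `s_i = g_ij s_j`. -/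
noncomputable def LineTriv.transition (t : LineTriv L U) (i j : ι) (x : X) : ℂ :=
  ((t i).triv ((t j).triv.toOpenPartialHomeomorph.symm (x, 1))).2

theorem LineTriv.transition_mul (t : LineTriv L U) (i j : ι) {x : X} (hi : x ∈ U i)
    (hj : x ∈ U j) (v : L.fiber x) :
    ((t i).triv ⟨x, v⟩).2 = t.transition i j x * ((t j).triv ⟨x, v⟩).2 := by
  have hi' : x ∈ (t i).triv.baseSet := by rw [(t i).baseSet_eq]; exact hi
  have hj' : x ∈ (t j).triv.baseSet := by rw [(t j).baseSet_eq]; exact hj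
  have h1 := (t i).linear
  have h2 := (t j).linear
  have hsym : (t j).triv.toOpenPartialHomeomorph.symm (x, 1) = ⟨x, (t j).triv.symm x 1⟩ :=
    ((t j).triv.mk_symm hj' 1).symm
  have hv : v = ((t j).triv ⟨x, v⟩).2 • (t j).triv.symm x 1 := by
    rw [← (t j).triv.symmₗ_apply (R := ℂ) hj', ← map_smul, smul_eq_mul, mul_one,
      (t j).triv.symmₗ_apply (R := ℂ) hj', Trivialization.symm_apply_apply_mk _ hj']
  have hlin := ((t i).triv.linear ℂ hi').map_smul ((t j).triv ⟨x, v⟩).2 ((t j).triv.symm x 1)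
  rw [LineTriv.transition, hsym, mul_comm, ← smul_eq_mul, ← hlin, ← hv]

theorem LineTriv.transition_ne_zero (t : LineTriv L U) (i j : ι) {x : X} (hi : x ∈ U i)
    (hj : x ∈ U j) : t.transition i j x ≠ 0 := by
  intro h0
  have hi' : x ∈ (t i).triv.baseSet := by rw [(t i).baseSet_eq]; exact hi
  have h := t.transition_mul i j hi hj ((t i).triv.symm x 1)
  rw [h0, zero_mul, Trivialization.apply_mk_symm _ hi'] at h
  exact one_ne_zero h

theorem LineTriv.transition_trans (t : LineTriv L U) (i j k : ι) {x : X} (hi : x ∈ U i)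
    (hj : x ∈ U j) (hk : x ∈ U k) :
    t.transition i k x = t.transition i j x * t.transition j k x := by
  have hk' : x ∈ (t k).triv.baseSet := by rw [(t k).baseSet_eq]; exact hk
  have h1 := t.transition_mul i k hi hk ((t k).triv.symm x 1)
  have h2 := t.transition_mul i j hi hj ((t k).triv.symm x 1)
  have h3 := t.transition_mul j k hj hk ((t k).triv.symm x 1)
  rw [Trivialization.apply_mk_symm _ hk', mul_one] at h1 h3
  rw [← h1, h2, h3]

theorem LineTriv.holOn_transition (t : LineTriv L U) (i j : ι) :
    HolOn (t.transition i j) ((U i ⊓ U j : Opens X) : Set X) := by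
  have h1 : ContMDiffOn 𝓘(ℂ) (𝓘(ℂ).prod 𝓘(ℂ)) ω (fun x : X => (x, (1 : ℂ)))
      ((U i ⊓ U j : Opens X) : Set X) := contMDiffOn_id.prodMk contMDiffOn_const
  have h2 := (t j).hol_symm.comp h1 (fun x hx => by
    rw [Set.mem_preimage, (t j).triv.mem_target, (t j).baseSet_eq]; exact hx.2)
  have h3 := (t i).hol.comp h2 (fun x hx => by
    rw [Set.mem_preimage, (t i).triv.mem_source, Function.comp_apply,
      (t j).triv.proj_symm_apply' (by rw [(t j).baseSet_eq]; exact hx.2), (t i).baseSet_eq]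
    exact hx.1)
  exact contMDiff_snd.comp_contMDiffOn h3

/-- The Cech cocycle `{d log g_ij}` with coefficients in `Ω¹` of a trivialized line bundle. -/
noncomputable def LineTriv.dlogCocycle (t : LineTriv L U) : Z1 U :=
  ⟨fun i j => ⟨fun x => dlog (t.transition i j) x, dlog_mem_Omega (t.holOn_transition i j)
    fun _ hx => t.transition_ne_zero i j hx.1 hx.2⟩, by
    refine LinearMap.mem_ker.2 ?_
    funext i j k
    apply Subtype.ext
    funext x
    have hx := x.2
    have h : dlog (t.transition i k) (x : X) =
        dlog (t.transition i j) (x : X) + dlog (t.transition j k) (x : X) := by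
      rw [← dlog_mul ((t.holOn_transition i j).mdifferentiableAt hx.1)
        ((t.holOn_transition j k).mdifferentiableAt ⟨hx.1.2, hx.2⟩)
        (t.transition_ne_zero i j hx.1.1 hx.1.2) (t.transition_ne_zero j k hx.1.2 hx.2)]
      apply dlog_congr
      filter_upwards [(U i ⊓ U j ⊓ U k).isOpen.mem_nhds hx] with y hy
      exact t.transition_trans i j k hy.1.1 hy.1.2 hy.2
    show dlog (t.transition j k) (x : X) - dlog (t.transition i k) (x : X) +
      dlog (t.transition i j) (x : X) = 0
    rw [h]
    abel⟩

/-- The first Chern class of `L` in `Ȟ¹(𝒰, Ω¹)`, the class of `{d log g_ij}`, computed by means of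
trivializations of `L` over the sets of the cover `𝒰`. -/
noncomputable def LineTriv.chernClass (t : LineTriv L U) : H1 U := cls U t.dlogCocycle

end Line

/-! ### Projectively flat bundles and Wronskians -/

section ProjectivelyFlat

variable {X : Type u} [TopologicalSpace X] [ChartedSpace ℂ X] {n : ℕ}

/-- The Wronskian determinant of `a : ℂ → ℂⁿ`. The `(r, c)` entry of the matrix is the `r`-th
derivative of the `c`-th component of `a`, where `0 ≤ r, c < n`. -/
noncomputable def wronskian (a : ℂ → Fin n → ℂ) (z : ℂ) : ℂ :=
  Matrix.det (Matrix.of fun r c : Fin n => iteratedDeriv r (fun y => a y c) z)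

/-- `p 0, …, p (n - 1)` are meromorphic functions on the open set `D` with
`a⁽ⁿ⁾ = p 0 • a⁽ⁿ⁻¹⁾ + p 1 • a⁽ⁿ⁻²⁾ + ⋯ + p (n - 1) • a`, as meromorphic functions on `D`. -/
def IsODE (a : ℂ → Fin n → ℂ) (D : Set ℂ) (p : Fin n → ℂ → ℂ) : Prop :=
  (∀ k, MeromorphicOn (p k) D) ∧
  ∀ᶠ z in Filter.codiscreteWithin D,
    iteratedDeriv n a z = ∑ k : Fin n, p k z • iteratedDeriv (n - 1 - k) a z

variable (V : X → Type v) [TopologicalSpace (TotalSpace (Fin n → ℂ) V)]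
  [∀ x, TopologicalSpace (V x)] [∀ x, AddCommGroup (V x)] [∀ x, Module ℂ (V x)]
  [FiberBundle (Fin n → ℂ) V]

variable {V} in
/-- On `S`, the two trivializations differ by `λ T`, with `λ` a nowhere zero holomorphic function
and `T` a constant invertible matrix. -/
def ProjConstOn (e e' : Trivialization (Fin n → ℂ) (π (Fin n → ℂ) V)) (S : Set X) : Prop :=
  ∃ lam : X → ℂ, HolOn lam S ∧ (∀ x ∈ S, lam x ≠ 0) ∧ ∃ T : GL (Fin n) ℂ,
    ∀ x ∈ S, ∀ v : V x,
      (e ⟨x, v⟩).2 = lam x • ((T : Matrix (Fin n) (Fin n) ℂ) *ᵥ (e' ⟨x, v⟩).2)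

/-- A projectively flat trivialization of the bundle `V` of rank `n`: an open cover by coordinate
domains, with trivializations whose transition functions are `λ_ij T_ij`. -/
structure PFTriv (ι : Type w) where
  /-- The open cover. -/
  U : ι → Opens X
  covers : ∀ x, ∃ i, x ∈ U i
  /-- The coordinate on `U i`. -/
  coord : ι → OpenPartialHomeomorph X ℂ
  coord_mem : ∀ i, coord i ∈ IsManifold.maximalAtlas 𝓘(ℂ) ω X
  coord_source : ∀ i, (coord i).source = U i
  /-- The holomorphic trivialization of `V` over `U i`. -/
  frame : ∀ i, HolTriv (Fin n → ℂ) V (U i)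
  projConst : ∀ i j, ProjConstOn (frame i).triv (frame j).triv ((U i ⊓ U j : Opens X) : Set X)

variable {V} {ι ι' : Type*}

namespace PFTriv

/-- Two projectively flat trivializations define the same projectively flat structure: their
trivializations differ by transition functions that are locally of the form `λ T`. -/
def Compatible (P : PFTriv (n := n) V ι) (P' : PFTriv (n := n) V ι') : Prop :=
  ∀ i j, ∀ x ∈ P.U i ⊓ P'.U j, ∃ N : Opens X, x ∈ N ∧
    ProjConstOn (P.frame i).triv (P'.frame j).triv ((P.U i ⊓ P'.U j ⊓ N : Opens X) : Set X)

/-- The section `A` over `U i` as a `ℂⁿ`-valued function `A_i` of the coordinate `z_i`. -/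
noncomputable def rep (P : PFTriv (n := n) V ι) (A : (x : X) → V x) (i : ι) : ℂ → Fin n → ℂ :=
  localRep (P.frame i).triv (P.coord i) A

/-- The Wronskian `w(A_i)` as a function of the coordinate `z_i`. -/
noncomputable def wr (P : PFTriv (n := n) V ι) (A : (x : X) → V x) (i : ι) : ℂ → ℂ :=
  wronskian (P.rep A i)

/-- The order at `x ∈ U i` of the Wronskian `w(A_i)`. -/
noncomputable def wrOrder (P : PFTriv (n := n) V ι) (A : (x : X) → V x) (i : ι) (x : X) :
    WithTop ℤ :=
  meromorphicOrderAt (P.wr A i) (P.coord i x)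

/-- The section `A` is generic: its Wronskian is not identically zero. -/
def IsGeneric (P : PFTriv (n := n) V ι) (A : (x : X) → V x) : Prop :=
  ∃ i, ∃ x ∈ P.U i, P.wrOrder A i x ≠ ⊤

/-- `L` is the Wronskian line bundle `w(V)`: the line bundle of the divisor class of `div(B)`, the
divisor of the Wronskian, for a generic meromorphic section `B` of `V`; that is, `L` has a
meromorphic section with divisor `div(B)`. -/
def IsWronskianLineBundle (P : PFTriv (n := n) V ι) (L : HolLineBundle X) : Prop :=
  ∃ B : (x : X) → V x, IsMeromorphicSection (Fin n → ℂ) B ∧ P.IsGeneric B ∧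
    ∃ s : (x : X) → L.fiber x, IsMeromorphicSection ℂ s ∧
      ∀ i, ∀ x ∈ P.U i, sectionOrder ℂ s x = P.wrOrder B i x

end PFTriv

end ProjectivelyFlat

end Wronskian

/-! The engine is one transformation rule. If `b = f · T(a ∘ φ)` with `f` a scalar function, `T` a
constant matrix and `φ` a change of coordinate, then every derivative of `b` is a combination of
derivatives of `a` at `φ` of no higher order. The Wronskian matrix of `b` is therefore a triangular
matrix times that of `a` at `φ` times `Tᵀ`, and `w(b) = fⁿ · det T · φ' ^ (0 + 1 + ⋯ + (n - 1)) ·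
w(a) ∘ φ` (`wronskian_smul_mulVec_comp`). The factor is holomorphic, has no zeros and does not
involve `a`. Hence the order of `w(A_i)` at a point depends neither on `i` nor on the choice among
compatible trivializations (`wrOrder_eq`), and `w(A_i) = λ_ij w(A_j)` with the same `λ_ij`, called
`factor`, for every section `A`.

One generic section, whose Wronskian by connectedness vanishes identically near no point, forces the
`λ_ij` to be a cocycle: cancel `w(A_k)` off a discrete set and extend by continuity. In the line
bundle of this cocycle the `w(A_i)` glue to a meromorphic section with divisor `div(A)`, which gives
existence. Conversely, let a line bundle have a meromorphic section `s` with divisor `div(B)`. Then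
`s / w(B_i)` extends to a holomorphic frame over `U_i`, in which `s` reads `w(B_i)`
(`exists_holTriv`); the transition functions of these frames are `w(B_i) / w(B_j) = λ_ij`, whatever
`B` is (`IsWronskianLineBundle.exists_lineTriv`).

The differential equation is Cramer's rule for the Wronskian matrix (`exists_isODE`). Abel's
identity `w' = p_1 w` (`deriv_wronskian`) says that `d log w(A_i) = p_1 dz_i`, and the logarithmic
differential of `w(A_i) = λ_ij w(A_j)` is the asserted formula. Two families of trivializations of
one line bundle over the same open sets give cohomologous cocycles (`LineTriv.chernClass_eq`), so
any family may be replaced by one with transition functions `λ_ij`. -/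

namespace Wronskian

/-! ### Wronskian determinants under changes of coordinate and frame -/

section Analysis

/-- The coefficient of `a⁽ˢ⁾ ∘ φ` in the `r`-th derivative of `f · (a ∘ φ)`. -/
noncomputable def chainCoeff (f φ : ℂ → ℂ) : ℕ → ℕ → ℂ → ℂ
  | 0, 0 => f
  | 0, _ + 1 => 0
  | r + 1, 0 => deriv (chainCoeff f φ r 0)
  | r + 1, s + 1 => deriv (chainCoeff f φ r (s + 1)) + chainCoeff f φ r s * deriv φ

theorem chainCoeff_eq_zero (f φ : ℂ → ℂ) {r s : ℕ} (h : r < s) : chainCoeff f φ r s = 0 := by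
  induction r generalizing s with
  | zero => cases s with
    | zero => omega
    | succ s => rfl
  | succ r ih => cases s with
    | zero => omega
    | succ s =>
      rw [chainCoeff, ih (by omega), ih (by omega), zero_mul, add_zero]
      exact deriv_zero

theorem chainCoeff_self (f φ : ℂ → ℂ) (r : ℕ) : chainCoeff f φ r r = f * deriv φ ^ r := by
  induction r with
  | zero => simp [chainCoeff]
  | succ r ih =>
    rw [chainCoeff, chainCoeff_eq_zero f φ (Nat.lt_succ_self r), ih, pow_succ, mul_assoc]
    have : deriv (0 : ℂ → ℂ) = 0 := deriv_zero
    rw [this, zero_add]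

theorem analyticAt_chainCoeff {f φ : ℂ → ℂ} {z : ℂ} (hf : AnalyticAt ℂ f z)
    (hφ : AnalyticAt ℂ φ z) (r s : ℕ) : AnalyticAt ℂ (chainCoeff f φ r s) z := by
  induction r generalizing s with
  | zero => cases s with
    | zero => exact hf
    | succ s => exact analyticAt_const
  | succ r ih => cases s with
    | zero => exact (ih 0).deriv
    | succ s => exact (ih (s + 1)).deriv.add ((ih s).mul hφ.deriv)

theorem _root_.AnalyticAt.iteratedDeriv_analyticAt {F : Type*} [NormedAddCommGroup F]
    [NormedSpace ℂ F] [CompleteSpace F] {a : ℂ → F} {z : ℂ} (ha : AnalyticAt ℂ a z) (r : ℕ) :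
    AnalyticAt ℂ (iteratedDeriv r a) z := by
  induction r with
  | zero => simpa using ha
  | succ r ih => rw [iteratedDeriv_succ]; exact ih.deriv

theorem _root_.AnalyticAt.hasDerivAt_iteratedDeriv {F : Type*} [NormedAddCommGroup F]
    [NormedSpace ℂ F] [CompleteSpace F] {a : ℂ → F} {z : ℂ} (ha : AnalyticAt ℂ a z) (r : ℕ) :
    HasDerivAt (iteratedDeriv r a) (iteratedDeriv (r + 1) a z) z := by
  rw [iteratedDeriv_succ]
  exact (ha.iteratedDeriv_analyticAt r).differentiableAt.hasDerivAt

/-- Iterated product and chain rule, by induction on `r`; equality of germs rather than of values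
lets each step be differentiated. The length `N` of the sum does not depend on `r`, so that the rows
`r < n` together form a product of square matrices. -/
theorem iteratedDeriv_mul_comp {f φ a : ℂ → ℂ} {z : ℂ} (hf : AnalyticAt ℂ f z)
    (hφ : AnalyticAt ℂ φ z) (ha : AnalyticAt ℂ a (φ z)) {r N : ℕ} (hr : r < N) :
    iteratedDeriv r (fun y => f y * a (φ y)) =ᶠ[𝓝 z]
      fun y => ∑ s ∈ Finset.range N, chainCoeff f φ r s y * iteratedDeriv s a (φ y) := by
  induction r with
  | zero =>
    refine Filter.Eventually.of_forall fun y => ?_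
    obtain ⟨M, rfl⟩ : ∃ M, N = M + 1 := ⟨N - 1, by omega⟩
    simp [Finset.sum_range_succ', chainCoeff]
  | succ r ih =>
    rw [iteratedDeriv_succ]
    refine (ih (by omega)).deriv.trans ?_
    filter_upwards [hf.eventually_analyticAt, hφ.eventually_analyticAt,
      hφ.continuousAt.eventually ha.eventually_analyticAt] with y hf hφ ha
    have h : ∀ s ∈ Finset.range N, HasDerivAt
        (fun y => chainCoeff f φ r s y * iteratedDeriv s a (φ y))
        (deriv (chainCoeff f φ r s) y * iteratedDeriv s a (φ y) +
          chainCoeff f φ r s y * (iteratedDeriv (s + 1) a (φ y) * deriv φ y)) y := fun s _ =>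
      (analyticAt_chainCoeff hf hφ r s).differentiableAt.hasDerivAt.mul
        ((ha.hasDerivAt_iteratedDeriv s).comp y hφ.differentiableAt.hasDerivAt)
    rw [(HasDerivAt.fun_sum h).deriv, Finset.sum_add_distrib]
    -- To compare coefficients of `a⁽ˢ⁺¹⁾`, the term `s = 0` is split off the first sum and the top
    -- term `s = M` off the second; the latter vanishes because `r < M`.
    obtain ⟨M, rfl⟩ : ∃ M, N = M + 1 := ⟨N - 1, by omega⟩
    rw [Finset.sum_range_succ', Finset.sum_range_succ (fun s => chainCoeff f φ r s y *
        (iteratedDeriv (s + 1) a (φ y) * deriv φ y)),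
      chainCoeff_eq_zero f φ (show r < M by omega), Finset.sum_range_succ' (fun s =>
        chainCoeff f φ (r + 1) s y * iteratedDeriv s a (φ y)), Pi.zero_apply, zero_mul, add_zero,
      add_right_comm, ← Finset.sum_add_distrib]
    simp only [chainCoeff, Pi.add_apply, Pi.mul_apply]
    congr 1
    exact Finset.sum_congr rfl fun s _ => by ring

variable {n : ℕ}

theorem analyticAt_apply {a : ℂ → Fin n → ℂ} {z : ℂ} (ha : AnalyticAt ℂ a z) (c : Fin n) :
    AnalyticAt ℂ (fun y => a y c) z :=
  ((ContinuousLinearMap.proj (R := ℂ) (φ := fun _ : Fin n => ℂ) c).analyticAt _).comp ha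

theorem meromorphicAt_apply {a : ℂ → Fin n → ℂ} {z : ℂ} (ha : MeromorphicAt a z) (c : Fin n) :
    MeromorphicAt (fun y => a y c) z := by
  obtain ⟨m, hm⟩ := ha
  exact ⟨m, analyticAt_apply hm c⟩

theorem iteratedDeriv_apply {a : ℂ → Fin n → ℂ} {z : ℂ} (ha : AnalyticAt ℂ a z) (r : ℕ)
    (c : Fin n) : iteratedDeriv r a z c = iteratedDeriv r (fun y => a y c) z := by
  suffices h : (fun y => iteratedDeriv r a y c) =ᶠ[𝓝 z] iteratedDeriv r (fun y => a y c) from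
    h.eq_of_nhds
  induction r with
  | zero => simp
  | succ r ih =>
    rw [iteratedDeriv_succ, iteratedDeriv_succ]
    refine Filter.EventuallyEq.trans ?_ ih.deriv
    filter_upwards [ha.eventually_analyticAt] with y hy
    exact (hasDerivAt_pi.1 (hy.iteratedDeriv_analyticAt r).differentiableAt.hasDerivAt c).deriv.symm

/-- The Wronskian matrices satisfy `W(b) = C · (W(a) ∘ φ) · Tᵀ`, where `C` is lower triangular with
diagonal entries `f φ' ^ r`. Constancy of `T` is essential: derivatives pass through it. -/
theorem wronskian_smul_mulVec_comp {f φ : ℂ → ℂ} {z : ℂ} {a b : ℂ → Fin n → ℂ}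
    (T : Matrix (Fin n) (Fin n) ℂ) (hf : AnalyticAt ℂ f z) (hφ : AnalyticAt ℂ φ z)
    (ha : AnalyticAt ℂ a (φ z)) (hb : b =ᶠ[𝓝 z] fun y => f y • (T *ᵥ a (φ y))) :
    wronskian b z =
      f z ^ n * T.det * (∏ r : Fin n, deriv φ z ^ (r : ℕ)) * wronskian a (φ z) := by
  have hac := fun c => analyticAt_apply ha c
  have hM : (Matrix.of fun r c : Fin n => iteratedDeriv r (fun y => b y c) z) =
      (Matrix.of fun r s : Fin n => chainCoeff f φ r s z) *
        (Matrix.of fun r c : Fin n => iteratedDeriv r (fun y => a y c) (φ z)) * Tᵀ := by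
    ext r c
    have hg : AnalyticAt ℂ (fun y => ∑ d, T c d * a y d) (φ z) :=
      Finset.analyticAt_fun_sum _ fun d _ => analyticAt_const.mul (hac d)
    have h1 : (fun y => b y c) =ᶠ[𝓝 z] fun y => f y * (fun x => ∑ d, T c d * a x d) (φ y) := by
      filter_upwards [hb] with y hy
      rw [hy]
      rfl
    have h2 : ∀ s : ℕ, iteratedDeriv s (fun y => ∑ d, T c d * a y d) (φ z) =
        ∑ d, T c d * iteratedDeriv s (fun y => a y d) (φ z) := by
      intro s
      rw [iteratedDeriv_fun_sum (f := fun d y => T c d * a y d) fun d _ =>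
        (analyticAt_const.mul (hac d)).contDiffAt]
      exact Finset.sum_congr rfl fun d _ => iteratedDeriv_const_mul_field _ _
    rw [Matrix.of_apply, (h1.iteratedDeriv r).eq_of_nhds,
      (iteratedDeriv_mul_comp hf hφ hg r.2).eq_of_nhds, Matrix.mul_apply]
    simp only [h2, Matrix.mul_apply, Matrix.of_apply, Matrix.transpose_apply]
    rw [Finset.sum_range]
    simp only [Finset.mul_sum, Finset.sum_mul]
    rw [Finset.sum_comm]
    exact Finset.sum_congr rfl fun d _ => Finset.sum_congr rfl fun s _ => by ring
  have hC : (Matrix.of fun r s : Fin n => chainCoeff f φ r s z).det =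
      f z ^ n * ∏ r : Fin n, deriv φ z ^ (r : ℕ) := by
    rw [Matrix.det_of_isLowerTriangular]
    · simp [chainCoeff_self, Finset.prod_mul_distrib]
    · intro r s hrs
      have : (r : ℕ) < s := hrs
      simp [chainCoeff_eq_zero f φ this]
  unfold wronskian
  rw [hM, Matrix.det_mul, Matrix.det_mul, hC, Matrix.det_transpose]
  ring

theorem _root_.MeromorphicAt.matrix_det {M : ℂ → Matrix (Fin n) (Fin n) ℂ} {z : ℂ}
    (h : ∀ r c, MeromorphicAt (fun y => M y r c) z) : MeromorphicAt (fun y => (M y).det) z := by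
  simp only [Matrix.det_apply']
  exact MeromorphicAt.fun_sum fun σ _ =>
    (MeromorphicAt.const _ _).mul (MeromorphicAt.fun_prod fun c _ => h _ _)

theorem _root_.MeromorphicAt.iteratedDeriv_meromorphicAt {F : Type*} [NormedAddCommGroup F]
    [NormedSpace ℂ F] [CompleteSpace F] {a : ℂ → F} {z : ℂ} (ha : MeromorphicAt a z) (r : ℕ) :
    MeromorphicAt (iteratedDeriv r a) z := by
  rw [iteratedDeriv_eq_iterate]
  exact ha.iterated_deriv

theorem _root_.MeromorphicAt.wronskian {a : ℂ → Fin n → ℂ} {z : ℂ} (ha : MeromorphicAt a z) :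
    MeromorphicAt (wronskian a) z :=
  MeromorphicAt.matrix_det fun r c => (meromorphicAt_apply ha c).iteratedDeriv_meromorphicAt r

theorem analyticAt_wronskian {a : ℂ → Fin n → ℂ} {z : ℂ} (ha : AnalyticAt ℂ a z) :
    AnalyticAt ℂ (wronskian a) z := by
  unfold wronskian
  simp only [Matrix.det_apply']
  exact Finset.analyticAt_fun_sum _ fun σ _ => analyticAt_const.mul
    (Finset.analyticAt_fun_prod _ fun c _ => (analyticAt_apply ha c).iteratedDeriv_analyticAt _)

/-- The determinant is a continuous multilinear map of the rows, so the Leibniz rule differentiates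
one row at a time. -/
theorem hasDerivAt_det {M : ℂ → Matrix (Fin n) (Fin n) ℂ} {M' : Matrix (Fin n) (Fin n) ℂ}
    {z : ℂ} (h : ∀ r c, HasDerivAt (fun y => M y r c) (M' r c) z) :
    HasDerivAt (fun y => (M y).det) (∑ r, ((M z).updateRow r (M' r)).det) z := by
  let D : ContinuousMultilinearMap ℂ (fun _ : Fin n => Fin n → ℂ) ℂ :=
    ⟨(Matrix.detRowAlternating (n := Fin n) (R := ℂ)).toMultilinearMap,
      Continuous.matrix_det continuous_id⟩
  have h2 := (D.hasFDerivAt (fun r => M z r)).comp_hasDerivAt z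
    (hasDerivAt_pi.2 fun r => hasDerivAt_pi.2 fun c => h r c)
  exact h2.congr_deriv (ContinuousMultilinearMap.linearDeriv_apply D _ _)

/-- Abel's identity. Differentiating any row but the last of the Wronskian matrix repeats the next
row, so only the determinant with last row `a⁽ⁿ⁾` remains. -/
theorem deriv_wronskian {a : ℂ → Fin n → ℂ} [NeZero n] {z : ℂ} (ha : AnalyticAt ℂ a z)
    {p : Fin n → ℂ}
    (hp : iteratedDeriv n a z = ∑ k : Fin n, p k • iteratedDeriv (n - 1 - k) a z) :
    deriv (wronskian a) z = p 0 * wronskian a z := by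
  obtain ⟨m, rfl⟩ : ∃ m, n = m + 1 := ⟨n - 1, (Nat.succ_pred_eq_of_ne_zero (NeZero.ne n)).symm⟩
  set M : Matrix (Fin (m + 1)) (Fin (m + 1)) ℂ :=
    Matrix.of fun r c => iteratedDeriv r (fun y => a y c) z with hM
  have h := hasDerivAt_det (M := fun y => Matrix.of fun r c : Fin (m + 1) =>
      iteratedDeriv r (fun y => a y c) y)
    (M' := Matrix.of fun r c => iteratedDeriv (r + 1) (fun y => a y c) z) (z := z)
    fun r c => (analyticAt_apply ha c).hasDerivAt_iteratedDeriv r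
  refine h.deriv.trans ?_
  rw [Fin.sum_univ_castSucc, Finset.sum_eq_zero, zero_add]
  -- The coefficient `p k` belongs to the derivative of order `n - 1 - k`, that is, to row `Fin.rev
  -- k`.
  · have hrow : (Matrix.of fun r c => iteratedDeriv (r + 1) (fun y => a y c) z :
        Matrix (Fin (m + 1)) (Fin (m + 1)) ℂ) (Fin.last m) = ∑ k, p (Fin.rev k) • M k := by
      funext c
      have := congrFun hp c
      rw [iteratedDeriv_apply ha] at this
      refine this.trans ?_
      rw [Finset.sum_apply, Finset.sum_apply, ← Equiv.sum_comp Fin.revPerm]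
      refine Finset.sum_congr rfl fun k _ => ?_
      have hk : m + 1 - 1 - (Fin.revPerm k : ℕ) = k := by
        rw [Fin.revPerm_apply, Fin.val_rev]; omega
      rw [hk, Pi.smul_apply, Pi.smul_apply, iteratedDeriv_apply ha]
      rfl
    rw [hrow]
    -- Of the combination of rows put in the last place, only the multiple of the last row itself
    -- counts; its coefficient is `p (Fin.rev (Fin.last m)) = p 0`.
    refine (Matrix.det_updateRow_sum M (Fin.last m) fun k => p (Fin.rev k)).trans ?_
    rw [Fin.rev_last]
    rfl
  · intro r _
    refine Matrix.det_zero_of_row_eq (i := r.castSucc) (j := r.succ)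
      (Fin.castSucc_lt_succ).ne ?_
    rw [Matrix.updateRow_self, Matrix.updateRow_ne (Fin.castSucc_lt_succ).ne']
    funext c
    simp

/-- Where the Wronskian is nonzero the rows `a, a', …, a⁽ⁿ⁻¹⁾` form a basis, and Cramer's rule
writes `a⁽ⁿ⁾` in it with coefficients that are quotients of meromorphic determinants. -/
theorem exists_isODE {a : ℂ → Fin n → ℂ} {D : Set ℂ} (ha : MeromorphicOn a D)
    (hw : ∀ z ∈ D, meromorphicOrderAt (wronskian a) z ≠ ⊤) : ∃ p, IsODE a D p := by
  set M : ℂ → Matrix (Fin n) (Fin n) ℂ := fun z =>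
    Matrix.of fun r c => iteratedDeriv r (fun y => a y c) z with hM
  refine ⟨fun k z => ((M z).updateRow (Fin.rev k) (iteratedDeriv n a z)).det / wronskian a z,
    fun k z hz => ?_, ?_⟩
  · refine (MeromorphicAt.matrix_det fun r c => ?_).div (ha z hz).wronskian
    rcases eq_or_ne r (Fin.rev k) with rfl | hr
    · simp only [Matrix.updateRow_self]
      exact meromorphicAt_apply ((ha z hz).iteratedDeriv_meromorphicAt n) c
    · simp only [Matrix.updateRow_ne hr]
      exact (meromorphicAt_apply (ha z hz) c).iteratedDeriv_meromorphicAt r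
  · rw [Filter.Eventually, mem_codiscreteWithin_iff_forall_mem_nhdsNE]
    intro z hz
    filter_upwards [(ha z hz).eventually_analyticAt,
      (meromorphicOrderAt_ne_top_iff_eventually_ne_zero (ha z hz).wronskian).1 (hw z hz)]
      with y hy hy0
    left
    -- The unknowns multiply the rows of `M y`, so the linear system has the transposed matrix.
    have h := Matrix.mulVec_cramer (M y)ᵀ (iteratedDeriv n a y)
    rw [Matrix.det_transpose] at h
    have h' : iteratedDeriv n a y = (wronskian a y)⁻¹ •
        ((M y)ᵀ *ᵥ (M y)ᵀ.cramer (iteratedDeriv n a y)) := by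
      rw [h]
      exact (inv_smul_smul₀ hy0 _).symm
    refine h'.trans ?_
    funext c
    rw [Pi.smul_apply, Finset.sum_apply, Matrix.mulVec, dotProduct, smul_eq_mul, Finset.mul_sum,
      ← Equiv.sum_comp Fin.revPerm]
    refine Finset.sum_congr rfl fun k _ => ?_
    have hk : n - 1 - (k : ℕ) = (Fin.rev k : ℕ) := by rw [Fin.val_rev]; omega
    rw [hk, Matrix.cramer_transpose_apply, Pi.smul_apply, iteratedDeriv_apply hy, Fin.revPerm_apply,
      smul_eq_mul, Matrix.transpose_apply]
    simp only [hM, Matrix.of_apply]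
    ring

end Analysis

/-! ### Coordinates, trivializations and meromorphy -/

section Punctured

variable {X : Type u} [TopologicalSpace X]

theorem eventually_symm_mem (φ : OpenPartialHomeomorph X ℂ) {x : X} (hx : x ∈ φ.source)
    {s : Set X} (hs : s ∈ 𝓝 x) : ∀ᶠ z in 𝓝 (φ x), φ.symm z ∈ s := by
  have h := φ.continuousAt_symm (φ.map_source hx)
  rw [ContinuousAt, φ.left_inv hx] at h
  exact h.eventually hs

theorem tendsto_coord_nhdsNE (φ : OpenPartialHomeomorph X ℂ) {x : X} (hx : x ∈ φ.source) :
    Filter.Tendsto φ (𝓝[≠] x) (𝓝[≠] (φ x)) := by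
  refine tendsto_nhdsWithin_iff.2 ⟨(φ.continuousAt hx).mono_left nhdsWithin_le_nhds, ?_⟩
  filter_upwards [self_mem_nhdsWithin, nhdsWithin_le_nhds (φ.open_source.mem_nhds hx)] with y hy hy'
  exact fun h => hy (φ.injOn hy' hx h)

theorem tendsto_coord_symm_nhdsNE (φ : OpenPartialHomeomorph X ℂ) {x : X} (hx : x ∈ φ.source) :
    Filter.Tendsto φ.symm (𝓝[≠] (φ x)) (𝓝[≠] x) := by
  refine tendsto_nhdsWithin_iff.2 ⟨?_, ?_⟩
  · have h := φ.continuousAt_symm (φ.map_source hx)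
    rw [ContinuousAt, φ.left_inv hx] at h
    exact h.mono_left nhdsWithin_le_nhds
  · filter_upwards [self_mem_nhdsWithin, nhdsWithin_le_nhds (φ.open_target.mem_nhds
      (φ.map_source hx))] with z hz hz' h
    exact hz (by rw [← φ.right_inv hz', show φ.symm z = x from h]; rfl)

theorem comp_symm_eventuallyEq {φ φ' : OpenPartialHomeomorph X ℂ} {x : X} (hx : x ∈ φ.source)
    (hx' : x ∈ φ'.source) {Y : Type*} (h : X → Y) :
    h ∘ φ.symm =ᶠ[𝓝 (φ x)] (h ∘ φ'.symm) ∘ (φ' ∘ φ.symm) := by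
  filter_upwards [eventually_symm_mem φ hx (φ'.open_source.mem_nhds hx')] with z hz
  simp [φ'.left_inv hz]

end Punctured

/-! ### Analyticity, meromorphy and order do not depend on the coordinate. -/

section Coordinates

theorem contDiffAt_omega_iff_analyticAt {F : Type*} [NormedAddCommGroup F] [NormedSpace ℂ F]
    [CompleteSpace F] {f : ℂ → F} {z : ℂ} : ContDiffAt ℂ ω f z ↔ AnalyticAt ℂ f z := by
  rw [← contDiffWithinAt_univ, contDiffWithinAt_omega_iff_analyticWithinAt, analyticWithinAt_univ]

variable {X : Type u} [TopologicalSpace X] [ChartedSpace ℂ X]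
  {F : Type*} [NormedAddCommGroup F] [NormedSpace ℂ F]

theorem contMDiffAt_coord {φ : OpenPartialHomeomorph X ℂ}
    (hφ : φ ∈ IsManifold.maximalAtlas 𝓘(ℂ) ω X) {x : X} (hx : x ∈ φ.source) :
    ContMDiffAt 𝓘(ℂ) 𝓘(ℂ) ω φ x :=
  (contMDiffOn_of_mem_maximalAtlas hφ x hx).contMDiffAt (φ.open_source.mem_nhds hx)

theorem contMDiffAt_coord_symm {φ : OpenPartialHomeomorph X ℂ}
    (hφ : φ ∈ IsManifold.maximalAtlas 𝓘(ℂ) ω X) {z : ℂ} (hz : z ∈ φ.target) :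
    ContMDiffAt 𝓘(ℂ) 𝓘(ℂ) ω φ.symm z :=
  (contMDiffOn_symm_of_mem_maximalAtlas hφ z hz).contMDiffAt (φ.open_target.mem_nhds hz)

theorem contMDiffAt_iff_analyticAt_comp_symm [CompleteSpace F] {φ : OpenPartialHomeomorph X ℂ}
    (hφ : φ ∈ IsManifold.maximalAtlas 𝓘(ℂ) ω X) {x : X} (hx : x ∈ φ.source) {f : X → F} :
    ContMDiffAt 𝓘(ℂ) 𝓘(ℂ, F) ω f x ↔ AnalyticAt ℂ (f ∘ φ.symm) (φ x) := by
  rw [← contDiffAt_omega_iff_analyticAt, ← contMDiffAt_iff_contDiffAt]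
  constructor
  · intro h
    refine ContMDiffAt.comp (φ x) ?_ (contMDiffAt_coord_symm hφ (φ.map_source hx))
    rwa [φ.left_inv hx]
  · intro h
    refine (ContMDiffAt.comp x h (contMDiffAt_coord hφ hx)).congr_of_eventuallyEq ?_
    filter_upwards [φ.open_source.mem_nhds hx] with y hy
    simp [φ.left_inv hy]

theorem _root_.AnalyticAt.contMDiffAt_comp_coord [CompleteSpace F] {φ : OpenPartialHomeomorph X ℂ}
    (hφ : φ ∈ IsManifold.maximalAtlas 𝓘(ℂ) ω X) {x : X} (hx : x ∈ φ.source) {g : ℂ → F}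
    (hg : AnalyticAt ℂ g (φ x)) : ContMDiffAt 𝓘(ℂ) 𝓘(ℂ, F) ω (g ∘ φ) x :=
  ContMDiffAt.comp x (contMDiffAt_iff_contDiffAt.2 (contDiffAt_omega_iff_analyticAt.2 hg))
    (contMDiffAt_coord hφ hx)

theorem analyticAt_transition {φ φ' : OpenPartialHomeomorph X ℂ}
    (hφ : φ ∈ IsManifold.maximalAtlas 𝓘(ℂ) ω X) (hφ' : φ' ∈ IsManifold.maximalAtlas 𝓘(ℂ) ω X)
    {x : X} (hx : x ∈ φ.source) (hx' : x ∈ φ'.source) :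
    AnalyticAt ℂ (φ' ∘ φ.symm) (φ x) :=
  (contMDiffAt_iff_analyticAt_comp_symm hφ hx).1 (contMDiffAt_coord hφ' hx')

/-- The two opposite transition maps compose to the identity, so by the chain rule their derivatives
have product 1. -/
theorem deriv_transition_ne_zero {φ φ' : OpenPartialHomeomorph X ℂ}
    (hφ : φ ∈ IsManifold.maximalAtlas 𝓘(ℂ) ω X) (hφ' : φ' ∈ IsManifold.maximalAtlas 𝓘(ℂ) ω X)
    {x : X} (hx : x ∈ φ.source) (hx' : x ∈ φ'.source) :
    deriv (φ' ∘ φ.symm) (φ x) ≠ 0 := by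
  have h1 := (analyticAt_transition hφ hφ' hx hx').differentiableAt.hasDerivAt
  have h2 := (analyticAt_transition hφ' hφ hx' hx).differentiableAt.hasDerivAt
  have h3 : (φ' ∘ φ.symm) (φ x) = φ' x := by simp [φ.left_inv hx]
  rw [← h3] at h2
  have h4 := h2.comp (φ x) h1
  have h5 : (φ ∘ φ'.symm) ∘ (φ' ∘ φ.symm) =ᶠ[𝓝 (φ x)] id := by
    filter_upwards [eventually_symm_mem φ hx (φ'.open_source.mem_nhds hx'),
      φ.open_target.mem_nhds (φ.map_source hx)] with z hz hz'
    simp [φ'.left_inv hz, φ.right_inv hz']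
  have h6 := h4.unique ((hasDerivAt_id (φ x)).congr_of_eventuallyEq h5)
  intro h0
  rw [h0, mul_zero] at h6
  exact zero_ne_one h6

/-- A Riemann surface has no isolated points; hence identities between continuous functions extend
across a removed point. -/
theorem nhdsNE_neBot (x : X) : (𝓝[≠] x).NeBot := by
  have hx := mem_chart_source ℂ x
  exact (tendsto_coord_symm_nhdsNE (chartAt ℂ x) hx).neBot

theorem meromorphicAt_comp_symm {φ φ' : OpenPartialHomeomorph X ℂ}
    (hφ : φ ∈ IsManifold.maximalAtlas 𝓘(ℂ) ω X) (hφ' : φ' ∈ IsManifold.maximalAtlas 𝓘(ℂ) ω X)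
    {x : X} (hx : x ∈ φ.source) (hx' : x ∈ φ'.source) {h : X → F}
    (hh : MeromorphicAt (h ∘ φ'.symm) (φ' x)) : MeromorphicAt (h ∘ φ.symm) (φ x) := by
  refine MeromorphicAt.congr ?_ ((comp_symm_eventuallyEq hx hx' h).filter_mono
    nhdsWithin_le_nhds).symm
  refine MeromorphicAt.comp_analyticAt ?_ (analyticAt_transition hφ hφ' hx hx')
  simpa [φ.left_inv hx] using hh

theorem meromorphicOrderAt_comp_symm {φ φ' : OpenPartialHomeomorph X ℂ}
    (hφ : φ ∈ IsManifold.maximalAtlas 𝓘(ℂ) ω X) (hφ' : φ' ∈ IsManifold.maximalAtlas 𝓘(ℂ) ω X)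
    {x : X} (hx : x ∈ φ.source) (hx' : x ∈ φ'.source) (h : X → F) :
    meromorphicOrderAt (h ∘ φ.symm) (φ x) = meromorphicOrderAt (h ∘ φ'.symm) (φ' x) := by
  rw [meromorphicOrderAt_congr ((comp_symm_eventuallyEq hx hx' h).filter_mono nhdsWithin_le_nhds),
    meromorphicOrderAt_comp_of_deriv_ne_zero (analyticAt_transition hφ hφ' hx hx')
      (deriv_transition_ne_zero hφ hφ' hx hx')]
  simp [φ.left_inv hx]

end Coordinates

section FibrewiseLinear

variable {F : Type*} [NormedAddCommGroup F] [NormedSpace ℂ F]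

/-- A family of injective homogeneous maps depending holomorphically on a parameter preserves
meromorphy and the order. -/
theorem meromorphicAt_fibrewise {G : ℂ → F → F} {z₀ : ℂ}
    (hG : ∀ b : ℂ → F, AnalyticAt ℂ b z₀ → AnalyticAt ℂ (fun z => G z (b z)) z₀)
    (hlin : ∀ᶠ z in 𝓝 z₀, ∀ (c : ℂ) (v : F), G z (c • v) = c • G z v)
    (hinj : ∀ v, G z₀ v = 0 → v = 0) {a : ℂ → F} (ha : MeromorphicAt a z₀) :
    MeromorphicAt (fun z => G z (a z)) z₀ ∧
      meromorphicOrderAt (fun z => G z (a z)) z₀ = meromorphicOrderAt a z₀ := by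
  by_cases htop : meromorphicOrderAt a z₀ = ⊤
  · have h0 : (fun z => G z (a z)) =ᶠ[𝓝[≠] z₀] fun _ => 0 := by
      filter_upwards [meromorphicOrderAt_eq_top_iff.1 htop, nhdsWithin_le_nhds hlin] with z hz hz'
      -- Homogeneity with scalar `0` gives `G z 0 = 0`; additivity of `G z` is not needed.
      have := hz' 0 0
      rw [zero_smul, zero_smul] at this
      rw [hz, this]
    refine ⟨(MeromorphicAt.const 0 z₀).congr h0.symm, ?_⟩
    rw [htop, meromorphicOrderAt_eq_top_iff]
    exact h0
  · obtain ⟨m, hm⟩ := WithTop.ne_top_iff_exists.1 htop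
    -- In `a = (z - z₀)ᵐ b` the scalar power passes through `G`, and injectivity at `z₀` keeps the
    -- leading value nonzero.
    obtain ⟨b, hb, hb0, hab⟩ := (meromorphicOrderAt_eq_int_iff ha).1 hm.symm
    have h1 : (fun z => G z (a z)) =ᶠ[𝓝[≠] z₀] fun z => (z - z₀) ^ m • G z (b z) := by
      filter_upwards [hab, nhdsWithin_le_nhds hlin] with z hz hz'
      rw [hz, hz']
    have h2 : MeromorphicAt (fun z => G z (a z)) z₀ :=
      MeromorphicAt.congr (MeromorphicAt.smul (by fun_prop) (hG b hb).meromorphicAt) h1.symm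
    refine ⟨h2, ?_⟩
    rw [← hm, meromorphicOrderAt_eq_int_iff h2]
    exact ⟨_, hG b hb, fun h => hb0 (hinj _ h), h1⟩

end FibrewiseLinear

/-! ### Change of holomorphic trivialization. -/

section Trivializations

variable {X : Type u} [TopologicalSpace X] [ChartedSpace ℂ X]
  {F : Type*} [NormedAddCommGroup F] [NormedSpace ℂ F]
  {E : X → Type v} [TopologicalSpace (TotalSpace F E)] [∀ x, TopologicalSpace (E x)]
  [∀ x, AddCommGroup (E x)] [∀ x, Module ℂ (E x)] [FiberBundle F E]

namespace HolTriv

variable {W W' : Opens X}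

theorem mem_baseSet (t : HolTriv F E W) {x : X} (hx : x ∈ W) : x ∈ t.triv.baseSet := by
  rw [t.baseSet_eq]; exact hx

/-- Holomorphy of a change of trivialization is expressed by its effect on holomorphic `g`, the form
that `meromorphicAt_fibrewise` takes as input. The map factors through the total space, by way of
the inverse of `t'` and then `t`. -/
theorem contMDiffAt_change (t : HolTriv F E W) (t' : HolTriv F E W') {x : X} (hx : x ∈ W)
    (hx' : x ∈ W') {g : X → F} (hg : ContMDiffAt 𝓘(ℂ) 𝓘(ℂ, F) ω g x) :
    ContMDiffAt 𝓘(ℂ) 𝓘(ℂ, F) ω (fun y => (t.triv ⟨y, t'.triv.symm y (g y)⟩).2) x := by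
  have h1 : ContMDiffAt 𝓘(ℂ) (𝓘(ℂ).prod 𝓘(ℂ, F)) ω (fun y => (y, g y)) x :=
    contMDiffAt_id.prodMk hg
  have hmem : (x, g x) ∈ t'.triv.target := t'.triv.mem_target.2 (t'.mem_baseSet hx')
  have h2 := ((t'.hol_symm _ hmem).contMDiffAt (t'.triv.open_target.mem_nhds hmem)).comp x h1
  have hmem' : t'.triv.toOpenPartialHomeomorph.symm (x, g x) ∈ t.triv.source := by
    rw [t.triv.mem_source, t'.triv.proj_symm_apply' (t'.mem_baseSet hx')]
    exact t.mem_baseSet hx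
  have h3 := ((t.hol _ hmem').contMDiffAt (t.triv.open_source.mem_nhds hmem')).comp x h2
  refine (contMDiffAt_snd.comp x h3).congr_of_eventuallyEq ?_
  filter_upwards [W'.isOpen.mem_nhds hx'] with y hy
  simp only [Function.comp_apply, t'.triv.mk_symm (t'.mem_baseSet hy)]

theorem apply_eq_change (t : HolTriv F E W) (t' : HolTriv F E W') {x : X} (hx' : x ∈ W')
    (v : E x) :
    (t.triv ⟨x, v⟩).2 = (t.triv ⟨x, t'.triv.symm x (t'.triv ⟨x, v⟩).2⟩).2 := by
  rw [t'.triv.symm_apply_apply_mk (t'.mem_baseSet hx')]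

theorem change_smul (t : HolTriv F E W) (t' : HolTriv F E W') {x : X} (hx : x ∈ W)
    (hx' : x ∈ W') (c : ℂ) (v : F) :
    (t.triv ⟨x, t'.triv.symm x (c • v)⟩).2 = c • (t.triv ⟨x, t'.triv.symm x v⟩).2 := by
  have h1 := t.linear
  have h2 := t'.linear
  have h3 : t'.triv.symm x (c • v) = c • t'.triv.symm x v := by
    rw [← t'.triv.symmₗ_apply (R := ℂ) (t'.mem_baseSet hx'), map_smul,
      t'.triv.symmₗ_apply (R := ℂ) (t'.mem_baseSet hx')]
  rw [h3]
  exact (t.triv.linear ℂ (t.mem_baseSet hx)).map_smul c _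

/-- The opposite change of trivialization recovers `v`, and it sends `0` to `0`. -/
theorem change_eq_zero (t : HolTriv F E W) (t' : HolTriv F E W') {x : X} (hx : x ∈ W)
    (hx' : x ∈ W') {v : F} (h : (t.triv ⟨x, t'.triv.symm x v⟩).2 = 0) : v = 0 := by
  have h1 := t'.apply_eq_change t hx (t'.triv.symm x v)
  have h2 := t'.change_smul t hx' hx 0 0
  rw [zero_smul, zero_smul] at h2
  rwa [h, h2, t'.triv.apply_mk_symm (t'.mem_baseSet hx')] at h1

theorem localRep_change (t : HolTriv F E W) (t' : HolTriv F E W') {x : X}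
    (hx' : x ∈ W') {φ : OpenPartialHomeomorph X ℂ} (hxφ : x ∈ φ.source)
    (σ : (x : X) → E x) :
    localRep t.triv φ σ =ᶠ[𝓝 (φ x)] fun z =>
      (t.triv ⟨φ.symm z, t'.triv.symm (φ.symm z) (localRep t'.triv φ σ z)⟩).2 := by
  filter_upwards [eventually_symm_mem φ hxφ (W'.isOpen.mem_nhds hx')] with z hz
  exact t.apply_eq_change t' hz _

theorem analyticAt_change [CompleteSpace F] (t : HolTriv F E W) (t' : HolTriv F E W') {x : X}
    (hx : x ∈ W) (hx' : x ∈ W') {φ : OpenPartialHomeomorph X ℂ}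
    (hφ : φ ∈ IsManifold.maximalAtlas 𝓘(ℂ) ω X) (hxφ : x ∈ φ.source) {b : ℂ → F}
    (hb : AnalyticAt ℂ b (φ x)) :
    AnalyticAt ℂ (fun z => (t.triv ⟨φ.symm z, t'.triv.symm (φ.symm z) (b z)⟩).2) (φ x) := by
  have h := (contMDiffAt_iff_analyticAt_comp_symm hφ hxφ).1
    (t.contMDiffAt_change t' hx hx' (hb.contMDiffAt_comp_coord hφ hxφ))
  refine h.congr ?_
  filter_upwards [φ.open_target.mem_nhds (φ.map_source hxφ)] with z hz
  simp [φ.right_inv hz]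

theorem analyticAt_localRep [CompleteSpace F] (t : HolTriv F E W) (t' : HolTriv F E W') {x : X}
    (hx : x ∈ W) (hx' : x ∈ W') {φ φ' : OpenPartialHomeomorph X ℂ}
    (hφ : φ ∈ IsManifold.maximalAtlas 𝓘(ℂ) ω X) (hφ' : φ' ∈ IsManifold.maximalAtlas 𝓘(ℂ) ω X)
    (hxφ : x ∈ φ.source) (hxφ' : x ∈ φ'.source) {σ : (x : X) → E x}
    (h : AnalyticAt ℂ (localRep t'.triv φ' σ) (φ' x)) :
    AnalyticAt ℂ (localRep t.triv φ σ) (φ x) := by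
  have h1 : AnalyticAt ℂ (localRep t'.triv φ σ) (φ x) :=
    (contMDiffAt_iff_analyticAt_comp_symm (f := fun y => (t'.triv ⟨y, σ y⟩).2) hφ hxφ).1
      ((contMDiffAt_iff_analyticAt_comp_symm hφ' hxφ').2 h)
  exact (t.analyticAt_change t' hx hx' hφ hxφ h1).congr (t.localRep_change t' hx' hxφ σ).symm

theorem meromorphicAt_localRep [CompleteSpace F] (t : HolTriv F E W) (t' : HolTriv F E W') {x : X}
    (hx : x ∈ W) (hx' : x ∈ W') {φ φ' : OpenPartialHomeomorph X ℂ}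
    (hφ : φ ∈ IsManifold.maximalAtlas 𝓘(ℂ) ω X) (hφ' : φ' ∈ IsManifold.maximalAtlas 𝓘(ℂ) ω X)
    (hxφ : x ∈ φ.source) (hxφ' : x ∈ φ'.source) {σ : (x : X) → E x}
    (h : MeromorphicAt (localRep t'.triv φ' σ) (φ' x)) :
    MeromorphicAt (localRep t.triv φ σ) (φ x) ∧
      meromorphicOrderAt (localRep t.triv φ σ) (φ x) =
        meromorphicOrderAt (localRep t'.triv φ' σ) (φ' x) := by
  have h1 : MeromorphicAt (localRep t'.triv φ σ) (φ x) :=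
    meromorphicAt_comp_symm (h := fun y => (t'.triv ⟨y, σ y⟩).2) hφ hφ' hxφ hxφ' h
  have h2 : meromorphicOrderAt (localRep t'.triv φ σ) (φ x) =
      meromorphicOrderAt (localRep t'.triv φ' σ) (φ' x) :=
    meromorphicOrderAt_comp_symm hφ hφ' hxφ hxφ' fun y => (t'.triv ⟨y, σ y⟩).2
  have heq := (t.localRep_change t' hx' hxφ σ).filter_mono
    (nhdsWithin_le_nhds (s := {φ x}ᶜ))
  obtain ⟨h3, h4⟩ := meromorphicAt_fibrewise
    (G := fun z v => (t.triv ⟨φ.symm z, t'.triv.symm (φ.symm z) v⟩).2)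
    (fun b hb => t.analyticAt_change t' hx hx' hφ hxφ hb)
    (by
      filter_upwards [eventually_symm_mem φ hxφ (W.isOpen.mem_nhds hx),
        eventually_symm_mem φ hxφ (W'.isOpen.mem_nhds hx')] with z hz hz' c v
      exact t.change_smul t' hz hz' c v)
    (fun v hv => by
      exact t.change_eq_zero t' (by rwa [φ.left_inv hxφ]) (by rwa [φ.left_inv hxφ]) hv) h1
  exact ⟨h3.congr heq.symm, by rw [meromorphicOrderAt_congr heq, h4, h2]⟩

end HolTriv

variable [VectorBundle ℂ F E] [ContMDiffVectorBundle ω F E 𝓘(ℂ)]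

/-- The members of the trivialization atlas of a holomorphic vector bundle are holomorphic. -/
noncomputable def HolTriv.ofMemAtlas (e : Trivialization F (π F E)) [MemTrivializationAtlas e] :
    HolTriv F E ⟨e.baseSet, e.open_baseSet⟩ where
  triv := e
  baseSet_eq := rfl
  linear := inferInstance
  hol := e.contMDiffOn
  hol_symm := e.contMDiffOn_symm

variable (F E) in
/-- The preferred trivialization at a point, as a holomorphic trivialization. -/
noncomputable abbrev HolTriv.at (x : X) :
    HolTriv F E ⟨(trivializationAt F E x).baseSet, (trivializationAt F E x).open_baseSet⟩ :=
  HolTriv.ofMemAtlas (trivializationAt F E x)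

variable [IsManifold 𝓘(ℂ) ω X] [CompleteSpace F]

theorem IsMeromorphicSection.meromorphicAt_localRep {σ : (x : X) → E x}
    (hσ : IsMeromorphicSection F σ) {W : Opens X} (t : HolTriv F E W)
    {φ : OpenPartialHomeomorph X ℂ} (hφ : φ ∈ IsManifold.maximalAtlas 𝓘(ℂ) ω X) {x : X}
    (hx : x ∈ W) (hxφ : x ∈ φ.source) :
    MeromorphicAt (localRep t.triv φ σ) (φ x) ∧
      meromorphicOrderAt (localRep t.triv φ σ) (φ x) = sectionOrder F σ x :=
  t.meromorphicAt_localRep (HolTriv.at F E x) hx (mem_baseSet_trivializationAt F E x) hφ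
    (IsManifold.chart_mem_maximalAtlas x) hxφ (mem_chart_source ℂ x) (hσ x)

end Trivializations

/-! ### The Wronskian of a section -/

section WronskianOfSection

/-- What holds on a punctured neighbourhood of `x` holds on a full neighbourhood of each nearby `y ≠
x`. This supplies both halves of the clopen argument in the identity theorem for Wronskians. -/
theorem isOpen_setOf_eventually_nhdsNE {X : Type*} [TopologicalSpace X] [T1Space X]
    {ι : Type*} (p : ι → X → Prop) (U : ι → Opens X) :
    IsOpen {x | ∃ i, x ∈ U i ∧ ∀ᶠ y in 𝓝[≠] x, p i y} := by
  refine isOpen_iff_mem_nhds.2 fun x ⟨i, hx, h⟩ => ?_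
  have h1 := eventually_nhdsWithin_iff.1 (eventually_nhdsNE_eventually_nhds_iff.2 h)
  filter_upwards [h1, (U i).isOpen.mem_nhds hx] with y hy hyU
  refine ⟨i, hyU, ?_⟩
  rcases eq_or_ne y x with rfl | hne
  · exact h
  · exact (hy hne).filter_mono nhdsWithin_le_nhds

variable {X : Type u} [TopologicalSpace X] [ChartedSpace ℂ X] {n : ℕ}

theorem meromorphicOrderAt_comp_symm_of_eventually_mul {φ φ' : OpenPartialHomeomorph X ℂ}
    (hφ : φ ∈ IsManifold.maximalAtlas 𝓘(ℂ) ω X) (hφ' : φ' ∈ IsManifold.maximalAtlas 𝓘(ℂ) ω X)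
    {x : X} (hx : x ∈ φ.source) (hx' : x ∈ φ'.source) {h h' μ : X → ℂ}
    (hμ : ContMDiffAt 𝓘(ℂ) 𝓘(ℂ) ω μ x) (hμ0 : μ x ≠ 0)
    (heq : ∀ᶠ y in 𝓝[≠] x, h y = μ y * h' y) :
    meromorphicOrderAt (h ∘ φ.symm) (φ x) = meromorphicOrderAt (h' ∘ φ'.symm) (φ' x) := by
  rw [← meromorphicOrderAt_comp_symm hφ hφ' hx hx' h']
  have h1 : h ∘ φ.symm =ᶠ[𝓝[≠] (φ x)] (μ ∘ φ.symm) * (h' ∘ φ.symm) :=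
    (tendsto_coord_symm_nhdsNE φ hx).eventually heq
  rw [meromorphicOrderAt_congr h1, meromorphicOrderAt_mul_of_ne_zero
    ((contMDiffAt_iff_analyticAt_comp_symm hφ hx).1 hμ)]
  simpa [φ.left_inv hx] using hμ0

variable {V : X → Type v} [TopologicalSpace (TotalSpace (Fin n → ℂ) V)]
  [∀ x, TopologicalSpace (V x)] [∀ x, AddCommGroup (V x)] [∀ x, Module ℂ (V x)]
  [FiberBundle (Fin n → ℂ) V]

/-- The Wronskians of a section in two projectively equivalent trivializations, with respect to two
coordinates, differ by a nowhere zero holomorphic factor that does not depend on the section. -/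
theorem exists_wronskian_factor {e e' : Trivialization (Fin n → ℂ) (π (Fin n → ℂ) V)}
    {S : Opens X} (h : ProjConstOn e e' (S : Set X)) {φ φ' : OpenPartialHomeomorph X ℂ}
    (hφ : φ ∈ IsManifold.maximalAtlas 𝓘(ℂ) ω X) (hφ' : φ' ∈ IsManifold.maximalAtlas 𝓘(ℂ) ω X)
    (hS : (S : Set X) ⊆ φ.source) (hS' : (S : Set X) ⊆ φ'.source) :
    ∃ μ : X → ℂ, HolOn μ S ∧ (∀ x ∈ S, μ x ≠ 0) ∧ ∀ (A : (x : X) → V x), ∀ x ∈ S,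
      AnalyticAt ℂ (localRep e' φ' A) (φ' x) →
      wronskian (localRep e φ A) (φ x) = μ x * wronskian (localRep e' φ' A) (φ' x) := by
  obtain ⟨lam, hlam, hlam0, T, hT⟩ := h
  -- The factor of `wronskian_smul_mulVec_comp`, with the powers `0, 1, …, n - 1` of the coordinate
  -- derivative collected in one exponent.
  refine ⟨fun x => lam x ^ n * (T : Matrix (Fin n) (Fin n) ℂ).det *
    deriv (φ' ∘ φ.symm) (φ x) ^ (∑ r : Fin n, (r : ℕ)), fun x hx => ?_, fun x hx => ?_,
    fun A x hx hA => ?_⟩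
  · have h1 : ContMDiffAt 𝓘(ℂ) 𝓘(ℂ) ω lam x := (hlam x hx).contMDiffAt (S.isOpen.mem_nhds hx)
    have h2 : ContMDiffAt 𝓘(ℂ) 𝓘(ℂ) ω (deriv (φ' ∘ φ.symm) ∘ φ) x :=
      (analyticAt_transition hφ hφ' (hS hx) (hS' hx)).deriv.contMDiffAt_comp_coord hφ (hS hx)
    exact (((h1.pow n).mul contMDiffAt_const).mul
      (h2.pow (∑ r : Fin n, (r : ℕ)))).contMDiffWithinAt
  · exact mul_ne_zero (mul_ne_zero (pow_ne_zero _ (hlam0 x hx))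
      ((Matrix.isUnit_iff_isUnit_det _).1 T.isUnit).ne_zero)
      (pow_ne_zero _ (deriv_transition_ne_zero hφ hφ' (hS hx) (hS' hx)))
  · have h1 : AnalyticAt ℂ (lam ∘ φ.symm) (φ x) :=
      (contMDiffAt_iff_analyticAt_comp_symm hφ (hS hx)).1
        ((hlam x hx).contMDiffAt (S.isOpen.mem_nhds hx))
    have h2 : (φ' ∘ φ.symm) (φ x) = φ' x := by simp [φ.left_inv (hS hx)]
    have h3 := wronskian_smul_mulVec_comp (b := localRep e φ A) (T : Matrix (Fin n) (Fin n) ℂ) h1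
      (analyticAt_transition hφ hφ' (hS hx) (hS' hx)) (a := localRep e' φ' A) (by rwa [h2]) (by
        filter_upwards [eventually_symm_mem φ (hS hx) (S.isOpen.mem_nhds hx)] with z hz
        have h4 : localRep e' φ' A ((φ' ∘ φ.symm) z) = (e' ⟨φ.symm z, A (φ.symm z)⟩).2 :=
          congrArg (fun y => (e' ⟨y, A y⟩).2) (φ'.left_inv (hS' hz))
        rw [h4]
        exact hT _ hz _)
    rw [h3, h2, Finset.prod_pow_eq_pow_sum, Function.comp_apply, φ.left_inv (hS hx)]

namespace PFTriv

variable {ι ι' : Type*} (P : PFTriv (n := n) V ι) (P' : PFTriv (n := n) V ι')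

theorem mem_source {i : ι} {x : X} (hx : x ∈ P.U i) : x ∈ (P.coord i).source := by
  rw [P.coord_source]; exact hx

theorem compatible_self : P.Compatible P := fun i j x _ => ⟨⊤, trivial, by
  rw [inf_top_eq]; exact P.projConst i j⟩

theorem exists_factor (i j : ι) : ∃ μ : X → ℂ, HolOn μ ((P.U i ⊓ P.U j : Opens X) : Set X) ∧
    (∀ x ∈ P.U i ⊓ P.U j, μ x ≠ 0) ∧ ∀ (A : (x : X) → V x), ∀ x ∈ P.U i ⊓ P.U j,
      AnalyticAt ℂ (P.rep A j) (P.coord j x) →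
      P.wr A i (P.coord i x) = μ x * P.wr A j (P.coord j x) :=
  exists_wronskian_factor (P.projConst i j) (P.coord_mem i) (P.coord_mem j)
    (fun _ hx => P.mem_source hx.1) (fun _ hx => P.mem_source hx.2)

/-- The nowhere zero holomorphic function `w(A_i) / w(A_j)` on `U_i ∩ U_j`, which is the same for
all sections `A`. -/
noncomputable def factor (i j : ι) : X → ℂ := (P.exists_factor i j).choose

theorem holOn_factor (i j : ι) : HolOn (P.factor i j) ((P.U i ⊓ P.U j : Opens X) : Set X) :=
  (P.exists_factor i j).choose_spec.1

theorem factor_ne_zero {i j : ι} {x : X} (hx : x ∈ P.U i ⊓ P.U j) : P.factor i j x ≠ 0 :=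
  (P.exists_factor i j).choose_spec.2.1 x hx

theorem contMDiffAt_factor {i j : ι} {x : X} (hx : x ∈ P.U i ⊓ P.U j) :
    ContMDiffAt 𝓘(ℂ) 𝓘(ℂ) ω (P.factor i j) x :=
  (P.holOn_factor i j x hx).contMDiffAt ((P.U i ⊓ P.U j).isOpen.mem_nhds hx)

variable {P P'} {A : (x : X) → V x}

theorem analyticAt_rep {i : ι} {j : ι'} {x : X} (hx : x ∈ P.U i)
    (hx' : x ∈ P'.U j) (h : AnalyticAt ℂ (P'.rep A j) (P'.coord j x)) :
    AnalyticAt ℂ (P.rep A i) (P.coord i x) :=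
  (P.frame i).analyticAt_localRep (P'.frame j) hx hx' (P.coord_mem i) (P'.coord_mem j)
    (P.mem_source hx) (P'.mem_source hx') h

theorem wr_eq_factor_mul {i j : ι} {x : X} (hx : x ∈ P.U i ⊓ P.U j)
    (h : AnalyticAt ℂ (P.rep A i) (P.coord i x)) :
    P.wr A i (P.coord i x) = P.factor i j x * P.wr A j (P.coord j x) :=
  (P.exists_factor i j).choose_spec.2.2 A x hx (analyticAt_rep hx.2 hx.1 h)

theorem wr_comp_symm_eventuallyEq {i : ι} {x : X} (hx : x ∈ P.U i) :
    (fun y => P.wr A i (P.coord i y)) ∘ (P.coord i).symm =ᶠ[𝓝[≠] (P.coord i x)] P.wr A i := by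
  refine Filter.EventuallyEq.filter_mono ?_ nhdsWithin_le_nhds
  filter_upwards [(P.coord i).open_target.mem_nhds ((P.coord i).map_source (P.mem_source hx))]
    with z hz
  simp [(P.coord i).right_inv hz]

theorem wrOrder_eq_comp {i : ι} {x : X} (hx : x ∈ P.U i) : P.wrOrder A i x =
    meromorphicOrderAt ((fun y => P.wr A i (P.coord i y)) ∘ (P.coord i).symm) (P.coord i x) :=
  (meromorphicOrderAt_congr (wr_comp_symm_eventuallyEq hx)).symm

theorem wrOrder_eq_top_iff {i : ι} {x : X} (hx : x ∈ P.U i) :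
    P.wrOrder A i x = ⊤ ↔ ∀ᶠ y in 𝓝[≠] x, P.wr A i (P.coord i y) = 0 := by
  rw [wrOrder, meromorphicOrderAt_eq_top_iff]
  refine ⟨fun h => (tendsto_coord_nhdsNE _ (P.mem_source hx)).eventually h, fun h => ?_⟩
  filter_upwards [(tendsto_coord_symm_nhdsNE _ (P.mem_source hx)).eventually h,
    nhdsWithin_le_nhds ((P.coord i).open_target.mem_nhds ((P.coord i).map_source
      (P.mem_source hx)))] with z hz hz'
  rwa [(P.coord i).right_inv hz'] at hz

variable [IsManifold 𝓘(ℂ) ω X] [VectorBundle ℂ (Fin n → ℂ) V]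
  [ContMDiffVectorBundle ω (Fin n → ℂ) V 𝓘(ℂ)]

theorem meromorphicAt_rep (hA : IsMeromorphicSection (Fin n → ℂ) A) {i : ι} {x : X}
    (hx : x ∈ P.U i) : MeromorphicAt (P.rep A i) (P.coord i x) :=
  (hA.meromorphicAt_localRep (P.frame i) (P.coord_mem i) hx (P.mem_source hx)).1

theorem meromorphicAt_wr (hA : IsMeromorphicSection (Fin n → ℂ) A) {i : ι} {x : X}
    (hx : x ∈ P.U i) : MeromorphicAt (P.wr A i) (P.coord i x) :=
  (meromorphicAt_rep hA hx).wronskian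

theorem meromorphicAt_wr_comp_symm (hA : IsMeromorphicSection (Fin n → ℂ) A) {i : ι} {x : X}
    (hx : x ∈ P.U i) :
    MeromorphicAt ((fun y => P.wr A i (P.coord i y)) ∘ (P.coord i).symm) (P.coord i x) :=
  (meromorphicAt_wr hA hx).congr (wr_comp_symm_eventuallyEq hx).symm

theorem eventually_analyticAt_rep (hA : IsMeromorphicSection (Fin n → ℂ) A) {i : ι} {x : X}
    (hx : x ∈ P.U i) : ∀ᶠ y in 𝓝[≠] x, AnalyticAt ℂ (P.rep A i) (P.coord i y) :=
  (tendsto_coord_nhdsNE (P.coord i) (P.mem_source hx)).eventually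
    (meromorphicAt_rep hA hx).eventually_analyticAt

theorem eventually_wr_eq_factor_mul (hA : IsMeromorphicSection (Fin n → ℂ) A) {i j : ι} {x : X}
    (hx : x ∈ P.U i ⊓ P.U j) :
    ∀ᶠ y in 𝓝[≠] x, P.wr A i (P.coord i y) = P.factor i j y * P.wr A j (P.coord j y) := by
  filter_upwards [eventually_analyticAt_rep hA hx.1,
    nhdsWithin_le_nhds ((P.U i ⊓ P.U j).isOpen.mem_nhds hx)] with y hy hy'
  exact wr_eq_factor_mul hy' hy

/-- This makes `div(A)` well defined: a nowhere zero holomorphic factor and a change of coordinate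
leave the order unchanged. With `P' = P` it compares two indices of one trivialization. -/
theorem wrOrder_eq (hA : IsMeromorphicSection (Fin n → ℂ) A) (hP : P.Compatible P') {i : ι}
    {j : ι'} {x : X} (hx : x ∈ P.U i) (hx' : x ∈ P'.U j) :
    P.wrOrder A i x = P'.wrOrder A j x := by
  obtain ⟨N, hN, hproj⟩ := hP i j x ⟨hx, hx'⟩
  obtain ⟨μ, hμ, hμ0, h⟩ := exists_wronskian_factor hproj (P.coord_mem i) (P'.coord_mem j)
    (fun _ hy => P.mem_source hy.1.1) (fun _ hy => P'.mem_source hy.1.2)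
  have hS : ((P.U i ⊓ P'.U j ⊓ N : Opens X) : Set X) ∈ 𝓝 x :=
    (P.U i ⊓ P'.U j ⊓ N).isOpen.mem_nhds ⟨⟨hx, hx'⟩, hN⟩
  rw [wrOrder_eq_comp hx, wrOrder_eq_comp hx']
  refine meromorphicOrderAt_comp_symm_of_eventually_mul (P.coord_mem i) (P'.coord_mem j)
    (P.mem_source hx) (P'.mem_source hx')
    ((hμ x ⟨⟨hx, hx'⟩, hN⟩).contMDiffAt hS) (hμ0 x ⟨⟨hx, hx'⟩, hN⟩) ?_
  filter_upwards [eventually_analyticAt_rep hA hx', nhdsWithin_le_nhds hS] with y hy hy'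
  exact h A y hy' hy

theorem wrOrder_ne_top_iff (hA : IsMeromorphicSection (Fin n → ℂ) A) {i : ι} {x : X}
    (hx : x ∈ P.U i) :
    P.wrOrder A i x ≠ ⊤ ↔ ∀ᶠ y in 𝓝[≠] x, P.wr A i (P.coord i y) ≠ 0 := by
  rw [wrOrder, meromorphicOrderAt_ne_top_iff_eventually_ne_zero (meromorphicAt_wr hA hx)]
  refine ⟨fun h => (tendsto_coord_nhdsNE _ (P.mem_source hx)).eventually h, fun h => ?_⟩
  filter_upwards [(tendsto_coord_symm_nhdsNE _ (P.mem_source hx)).eventually h,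
    nhdsWithin_le_nhds ((P.coord i).open_target.mem_nhds ((P.coord i).map_source
      (P.mem_source hx)))] with z hz hz'
  rwa [(P.coord i).right_inv hz'] at hz

/-- Identity theorem: the points with finite order form a clopen set, nonempty by genericity, hence
all of the connected surface. -/
theorem IsGeneric.wrOrder_ne_top [T1Space X] [PreconnectedSpace X]
    (hA : IsMeromorphicSection (Fin n → ℂ) A) (hgen : P.IsGeneric A) {i : ι} {x : X}
    (hx : x ∈ P.U i) : P.wrOrder A i x ≠ ⊤ := by
  obtain ⟨i₀, x₀, hx₀, h₀⟩ := hgen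
  set S : Set X := {x | ∃ i, x ∈ P.U i ∧ ∀ᶠ y in 𝓝[≠] x, P.wr A i (P.coord i y) ≠ 0} with hS
  -- A meromorphic function is either zero or nonzero throughout some punctured neighbourhood, so
  -- the complement is a set of the same shape; `wrOrder_eq` removes the dependence on the index.
  have hcompl : Sᶜ = {x | ∃ i, x ∈ P.U i ∧ ∀ᶠ y in 𝓝[≠] x, P.wr A i (P.coord i y) = 0} := by
    ext x
    constructor
    · intro hx
      obtain ⟨i, hi⟩ := P.covers x
      refine ⟨i, hi, (wrOrder_eq_top_iff hi).1 ?_⟩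
      by_contra h
      exact hx ⟨i, hi, (wrOrder_ne_top_iff hA hi).1 h⟩
    · rintro ⟨i, hi, h⟩ ⟨j, hj, h'⟩
      refine (wrOrder_ne_top_iff hA hj).2 h' ?_
      rw [← wrOrder_eq hA P.compatible_self hi hj]
      exact (wrOrder_eq_top_iff hi).2 h
  have hclopen : IsClopen S := by
    refine ⟨?_, isOpen_setOf_eventually_nhdsNE (fun i y => P.wr A i (P.coord i y) ≠ 0) P.U⟩
    rw [← isOpen_compl_iff, hcompl]
    exact isOpen_setOf_eventually_nhdsNE (fun i y => P.wr A i (P.coord i y) = 0) P.U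
  have huniv := hclopen.eq_univ ⟨x₀, i₀, hx₀, (wrOrder_ne_top_iff hA hx₀).1 h₀⟩
  obtain ⟨j, hj, h⟩ : x ∈ S := by rw [huniv]; trivial
  rw [wrOrder_eq hA P.compatible_self hx hj]
  exact (wrOrder_ne_top_iff hA hj).2 h

theorem IsGeneric.wrOrder_ne_top_of_compatible [T1Space X] [PreconnectedSpace X]
    (hA : IsMeromorphicSection (Fin n → ℂ) A) (hgen : P'.IsGeneric A) (hP : P.Compatible P')
    {i : ι} {x : X} (hx : x ∈ P.U i) : P.wrOrder A i x ≠ ⊤ := by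
  obtain ⟨j, hj⟩ := P'.covers x
  rw [wrOrder_eq hA hP hx hj]
  exact IsGeneric.wrOrder_ne_top hA hgen hj

end PFTriv

end WronskianOfSection

/-! ### The line bundle of a cocycle -/

section Cocycle

variable {X : Type u} [TopologicalSpace X] [ChartedSpace ℂ X] {ι : Type*}

theorem eq_of_eventually_nhdsNE_eq {f g : X → ℂ} {x : X} (hf : ContinuousAt f x)
    (hg : ContinuousAt g x) (h : ∀ᶠ y in 𝓝[≠] x, f y = g y) : f x = g x :=
  have := nhdsNE_neBot x
  tendsto_nhds_unique_of_eventuallyEq (hf.mono_left nhdsWithin_le_nhds)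
    (hg.mono_left nhdsWithin_le_nhds) h

/-- A multiplicative Cech cocycle of nowhere zero holomorphic functions. -/
structure IsHolCocycle (U : ι → Opens X) (g : ι → ι → X → ℂ) : Prop where
  covers : ∀ x, ∃ i, x ∈ U i
  hol : ∀ i j, HolOn (g i j) ((U i ⊓ U j : Opens X) : Set X)
  ne_zero : ∀ i j, ∀ x ∈ U i ⊓ U j, g i j x ≠ 0
  mul : ∀ i j k, ∀ x ∈ U i ⊓ U j ⊓ U k, g i j x * g j k x = g i k x

namespace IsHolCocycle

variable {U : ι → Opens X} {g : ι → ι → X → ℂ}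

theorem self_eq_one (h : IsHolCocycle U g) {i : ι} {x : X} (hx : x ∈ U i) : g i i x = 1 :=
  mul_left_cancel₀ (h.ne_zero i i x ⟨hx, hx⟩)
    ((h.mul i i i x ⟨⟨hx, hx⟩, hx⟩).trans (mul_one _).symm)

theorem contMDiffOn_smul_id (h : IsHolCocycle U g) (i j : ι) : ContMDiffOn 𝓘(ℂ) 𝓘(ℂ, ℂ →L[ℂ] ℂ) ω
    (fun x => g j i x • ContinuousLinearMap.id ℂ ℂ) ((U i : Set X) ∩ U j) := by
  have h1 : ContMDiffOn 𝓘(ℂ) 𝓘(ℂ) ω (g j i) ((U i : Set X) ∩ U j) :=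
    (h.hol j i).mono fun x hx => ⟨hx.2, hx.1⟩
  exact h1.smul contMDiffOn_const

variable (h : IsHolCocycle U g)

/-- The line bundle with transition functions `g i j`, as a bundle core. -/
noncomputable def core : VectorBundleCore ℂ X ℂ ι where
  baseSet i := U i
  isOpen_baseSet i := (U i).isOpen
  indexAt x := (h.covers x).choose
  mem_baseSet_at x := (h.covers x).choose_spec
  -- `coordChange i j` takes coordinates in index `i` to those in index `j`, and `s_j = g_ji s_i`;
  -- hence the reversed indices.
  coordChange i j x := g j i x • ContinuousLinearMap.id ℂ ℂ
  coordChange_self i x hx v := by simp [h.self_eq_one hx]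
  continuousOn_coordChange i j := (h.contMDiffOn_smul_id i j).continuousOn
  coordChange_comp i j k x hx v := by
    simp [← h.mul k j i x ⟨⟨hx.2, hx.1.2⟩, hx.1.1⟩, mul_assoc]

instance isContMDiff_core : h.core.IsContMDiff 𝓘(ℂ) ω where
  contMDiffOn_coordChange i j := h.contMDiffOn_smul_id i j

/-- The holomorphic line bundle with transition functions `g i j`. -/
noncomputable def lineBundle : HolLineBundle.{u, 0} X where
  fiber := h.core.Fiber
  topFiber := h.core.topologicalSpaceFiber
  addFiber := h.core.addCommGroupFiber
  modFiber := h.core.moduleFiber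

/-- The section of the line bundle of a cocycle with local expressions `s i`. -/
noncomputable def glue (s : ι → X → ℂ) (x : X) : h.lineBundle.fiber x :=
  s (h.core.indexAt x) x

/-- The glued section at a nearby `y` is recorded in the preferred index of `y`, which may jump with
`y`. The relation `s_i = g_ij s_j` brings it back to the index fixed at `x`. -/
theorem localRepAt_glue {s : ι → X → ℂ} {x : X} {i : ι} (hi : i = h.core.indexAt x)
    (hs : ∀ᶠ y in 𝓝[≠] x, ∀ j, y ∈ U j → s i y = g i j y * s j y) :
    localRepAt (F := ℂ) x (h.glue s) =ᶠ[𝓝[≠] (chartAt ℂ x x)] s i ∘ (chartAt ℂ x).symm := by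
  subst hi
  filter_upwards [(tendsto_coord_symm_nhdsNE _ (mem_chart_source ℂ x)).eventually hs] with z hz
  rw [Function.comp_apply, hz _ (h.core.mem_baseSet_at _)]
  rfl

end IsHolCocycle

end Cocycle

/-! ### Existence of the Wronskian line bundle. -/

section Existence

variable {X : Type u} [TopologicalSpace X] [ChartedSpace ℂ X] [IsManifold 𝓘(ℂ) ω X] {n : ℕ}
  {V : X → Type v} [TopologicalSpace (TotalSpace (Fin n → ℂ) V)]
  [∀ x, TopologicalSpace (V x)] [∀ x, AddCommGroup (V x)] [∀ x, Module ℂ (V x)]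
  [FiberBundle (Fin n → ℂ) V] [VectorBundle ℂ (Fin n → ℂ) V]
  [ContMDiffVectorBundle ω (Fin n → ℂ) V 𝓘(ℂ)] {ι : Type*} {P : PFTriv (n := n) V ι}
  {A : (x : X) → V x}

namespace PFTriv

/-- Applied to `A`, both sides multiply `w(A_k)` to `w(A_i)`. As `w(A_k)` is nonzero off a discrete
set they agree there, and everywhere by continuity. -/
theorem isHolCocycle_factor (hA : IsMeromorphicSection (Fin n → ℂ) A)
    (hne : ∀ i, ∀ x ∈ P.U i, P.wrOrder A i x ≠ ⊤) : IsHolCocycle P.U P.factor where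
  covers := P.covers
  hol := P.holOn_factor
  ne_zero _ _ _ hx := P.factor_ne_zero hx
  mul i j k x hx := by
    have hij : x ∈ P.U i ⊓ P.U j := hx.1
    have hjk : x ∈ P.U j ⊓ P.U k := ⟨hx.1.2, hx.2⟩
    have hik : x ∈ P.U i ⊓ P.U k := ⟨hx.1.1, hx.2⟩
    refine eq_of_eventually_nhdsNE_eq (f := fun y => P.factor i j y * P.factor j k y)
      ((P.contMDiffAt_factor hij).continuousAt.mul (P.contMDiffAt_factor hjk).continuousAt)
      (P.contMDiffAt_factor hik).continuousAt ?_
    filter_upwards [eventually_wr_eq_factor_mul hA hij, eventually_wr_eq_factor_mul hA hjk,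
      eventually_wr_eq_factor_mul hA hik, (wrOrder_ne_top_iff hA hx.2).1 (hne k x hx.2)]
      with y h1 h2 h3 h4
    refine mul_right_cancel₀ h4 ?_
    rw [← h3, h1, h2, mul_assoc]

theorem exists_isWronskianLineBundle [T1Space X] [PreconnectedSpace X]
    (hA : IsMeromorphicSection (Fin n → ℂ) A) (hgen : P.IsGeneric A) :
    ∃ L : HolLineBundle.{u, 0} X, P.IsWronskianLineBundle L := by
  have h := isHolCocycle_factor hA fun i x hx => hgen.wrOrder_ne_top hA hx
  set s : ι → X → ℂ := fun i y => P.wr A i (P.coord i y) with hs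
  have hrep : ∀ x, localRepAt (F := ℂ) x (h.glue s) =ᶠ[𝓝[≠] (chartAt ℂ x x)]
      s (h.core.indexAt x) ∘ (chartAt ℂ x).symm := fun x => by
    refine h.localRepAt_glue rfl ?_
    have hx : x ∈ P.U (h.core.indexAt x) := h.core.mem_baseSet_at x
    filter_upwards [eventually_analyticAt_rep hA hx,
      nhdsWithin_le_nhds ((P.U (h.core.indexAt x)).isOpen.mem_nhds hx)] with y hy hyU j hj
    exact wr_eq_factor_mul ⟨hyU, hj⟩ hy
  have hmem : ∀ x, x ∈ P.U (h.core.indexAt x) := h.core.mem_baseSet_at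
  refine ⟨h.lineBundle, A, hA, hgen, h.glue s, fun x => ?_, fun i x hx => ?_⟩
  · refine MeromorphicAt.congr ?_ (hrep x).symm
    exact meromorphicAt_comp_symm (IsManifold.chart_mem_maximalAtlas x)
      (P.coord_mem (h.core.indexAt x)) (mem_chart_source ℂ x) (P.mem_source (hmem x))
      (meromorphicAt_wr_comp_symm hA (hmem x))
  · rw [wrOrder_eq hA P.compatible_self hx (hmem x), wrOrder_eq_comp (hmem x)]
    refine (meromorphicOrderAt_congr (hrep x)).trans ?_
    exact meromorphicOrderAt_comp_symm (IsManifold.chart_mem_maximalAtlas x)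
      (P.coord_mem (h.core.indexAt x)) (mem_chart_source ℂ x) (P.mem_source (hmem x)) _

end PFTriv

end Existence

/-! ### Trivializations of line bundles -/

section Trivialize

variable {X : Type u} [TopologicalSpace X] [ChartedSpace ℂ X]

/-- The preferred trivializations of a line bundle at all points. -/
noncomputable def HolLineBundle.preferred (L : HolLineBundle.{u, v} X) :
    LineTriv L fun x : X =>
      (⟨(trivializationAt ℂ L.fiber x).baseSet, (trivializationAt ℂ L.fiber x).open_baseSet⟩ :
        Opens X) :=
  fun x => HolTriv.at ℂ L.fiber x

variable {L : HolLineBundle.{u, v} X}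

/-- `k y` is the value at `y`, in the preferred trivialization there, of a nowhere zero holomorphic
section over `W`. The function `q x` expresses that section near `x`, in the preferred
trivialization at `x`. -/
structure IsFrame (L : HolLineBundle.{u, v} X) (W : Opens X) (k : X → ℂ) (q : X → X → ℂ) :
    Prop where
  hol : ∀ x ∈ W, ContMDiffAt 𝓘(ℂ) 𝓘(ℂ) ω (q x) x
  ne_zero : ∀ x ∈ W, q x x ≠ 0
  eventually_eq : ∀ x ∈ W, ∀ᶠ y in 𝓝 x, q x y = L.preferred.transition x y y * k y

namespace IsFrame

variable {W : Opens X} {k : X → ℂ} {q : X → X → ℂ} (h : IsFrame L W k q)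

theorem frame_ne_zero (h : IsFrame L W k q) {x : X} (hx : x ∈ W) : k x ≠ 0 := fun h0 => by
  have h1 := (h.eventually_eq x hx).self_of_nhds
  rw [h0, mul_zero] at h1
  exact h.ne_zero x hx h1

theorem eventually_coord (h : IsFrame L W k q) {x : X} (hx : x ∈ W) :
    ∀ᶠ y in 𝓝 x, y ∈ W ∧ y ∈ (trivializationAt ℂ L.fiber x).baseSet ∧ q x y ≠ 0 ∧
      q x y = L.preferred.transition x y y * k y := by
  filter_upwards [W.isOpen.mem_nhds hx, (trivializationAt ℂ L.fiber x).open_baseSet.mem_nhds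
    (mem_baseSet_trivializationAt ℂ L.fiber x),
    (h.hol x hx).continuousAt.eventually_ne (h.ne_zero x hx), h.eventually_eq x hx]
    with y h1 h2 h3 h4
  exact ⟨h1, h2, h3, h4⟩

/-- The coordinate of a vector in the frame is defined through the preferred trivialization at its
own, moving base point. The transition factor cancels in the quotient, so near `x` the fixed
trivialization at `x` computes it, and holomorphy becomes visible. `symm_eq_symm` does the same for
the inverse. -/
theorem div_eq_div {x y : X}
    (hxy : y ∈ (trivializationAt ℂ L.fiber x).baseSet)
    (hq : q x y = L.preferred.transition x y y * k y) (v : L.fiber y) :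
    (trivializationAt ℂ L.fiber y ⟨y, v⟩).2 / k y =
      (trivializationAt ℂ L.fiber x ⟨y, v⟩).2 / q x y := by
  have hyy := mem_baseSet_trivializationAt ℂ L.fiber y
  have h1 : (trivializationAt ℂ L.fiber x ⟨y, v⟩).2 =
    L.preferred.transition x y y * (trivializationAt ℂ L.fiber y ⟨y, v⟩).2 :=
    L.preferred.transition_mul x y hxy hyy v
  rw [h1, hq, mul_div_mul_left _ _ (L.preferred.transition_ne_zero x y hxy hyy)]

theorem symm_eq_symm {x y : X}
    (hxy : y ∈ (trivializationAt ℂ L.fiber x).baseSet)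
    (hq : q x y = L.preferred.transition x y y * k y) (c : ℂ) :
    (trivializationAt ℂ L.fiber y).symm y (c * k y) =
      (trivializationAt ℂ L.fiber x).symm y (c * q x y) := by
  have hyy := mem_baseSet_trivializationAt ℂ L.fiber y
  have h1 : (trivializationAt ℂ L.fiber x
      ⟨y, (trivializationAt ℂ L.fiber y).symm y (c * k y)⟩).2 = L.preferred.transition x y y *
        (trivializationAt ℂ L.fiber y ⟨y, (trivializationAt ℂ L.fiber y).symm y (c * k y)⟩).2 :=
    L.preferred.transition_mul x y hxy hyy _
  rw [Trivialization.apply_mk_symm _ hyy] at h1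
  rw [hq, mul_left_comm, ← h1, Trivialization.symm_apply_apply_mk _ hxy]

/-- The coordinates of vectors with respect to a frame. -/
noncomputable def toFun (_ : IsFrame L W k q) (p : TotalSpace ℂ L.fiber) : X × ℂ :=
  (p.1, (trivializationAt ℂ L.fiber p.1 p).2 / k p.1)

/-- The vector with given coordinates with respect to a frame. -/
noncomputable def invFun (_ : IsFrame L W k q) (p : X × ℂ) : TotalSpace ℂ L.fiber :=
  ⟨p.1, (trivializationAt ℂ L.fiber p.1).symm p.1 (p.2 * k p.1)⟩

theorem contMDiffOn_toFun : ContMDiffOn (𝓘(ℂ).prod 𝓘(ℂ)) (𝓘(ℂ).prod 𝓘(ℂ)) ω h.toFun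
    (π ℂ L.fiber ⁻¹' W) := by
  rintro ⟨x, v⟩ hx
  refine ContMDiffAt.contMDiffWithinAt ?_
  have hproj : ContMDiffAt (𝓘(ℂ).prod 𝓘(ℂ)) 𝓘(ℂ) ω (π ℂ L.fiber) ⟨x, v⟩ := contMDiffAt_proj L.fiber
  have hmem : (⟨x, v⟩ : TotalSpace ℂ L.fiber) ∈ (trivializationAt ℂ L.fiber x).source :=
    (Trivialization.mem_source _).2 (mem_baseSet_trivializationAt ℂ L.fiber x)
  have h1 := ((HolTriv.at ℂ L.fiber x).hol _ hmem).contMDiffAt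
    ((trivializationAt ℂ L.fiber x).open_source.mem_nhds hmem)
  have h2 : ContMDiffAt (𝓘(ℂ).prod 𝓘(ℂ)) 𝓘(ℂ) ω (fun p : TotalSpace ℂ L.fiber => q x p.1) ⟨x, v⟩ :=
    ContMDiffAt.comp (g := q x) _ (h.hol x hx) hproj
  refine (hproj.prodMk ((contMDiffAt_snd.comp _ h1).div₀ h2 (h.ne_zero x hx))).congr_of_eventuallyEq
    ?_
  filter_upwards [hproj.continuousAt.eventually (h.eventually_coord hx)] with p hp
  exact Prod.ext rfl (div_eq_div hp.2.1 hp.2.2.2 p.2)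

theorem contMDiffOn_invFun : ContMDiffOn (𝓘(ℂ).prod 𝓘(ℂ)) (𝓘(ℂ).prod 𝓘(ℂ)) ω h.invFun
    ((W : Set X) ×ˢ Set.univ) := by
  rintro ⟨x, c⟩ ⟨hx, -⟩
  refine ContMDiffAt.contMDiffWithinAt ?_
  have hfst : ContMDiffAt (𝓘(ℂ).prod 𝓘(ℂ)) 𝓘(ℂ) ω Prod.fst (x, c) := contMDiffAt_fst
  have h2 : ContMDiffAt (𝓘(ℂ).prod 𝓘(ℂ)) 𝓘(ℂ) ω (fun p : X × ℂ => q x p.1) (x, c) :=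
    ContMDiffAt.comp (g := q x) _ (h.hol x hx) hfst
  have h3 : ContMDiffAt (𝓘(ℂ).prod 𝓘(ℂ)) (𝓘(ℂ).prod 𝓘(ℂ)) ω
      (fun p : X × ℂ => (p.1, p.2 * q x p.1)) (x, c) := hfst.prodMk (contMDiffAt_snd.mul h2)
  have hmem : (x, c * q x x) ∈ (trivializationAt ℂ L.fiber x).target :=
    (Trivialization.mem_target _).2 (mem_baseSet_trivializationAt ℂ L.fiber x)
  have h1 := ((HolTriv.at ℂ L.fiber x).hol_symm _ hmem).contMDiffAt
    ((trivializationAt ℂ L.fiber x).open_target.mem_nhds hmem)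
  refine (ContMDiffAt.comp (x, c) h1 h3).congr_of_eventuallyEq ?_
  filter_upwards [hfst.continuousAt.eventually (h.eventually_coord hx)] with p hp
  rw [invFun, symm_eq_symm hp.2.1 hp.2.2.2, Trivialization.mk_symm _ hp.2.1]
  rfl

/-- The holomorphic trivialization given by a frame. -/
noncomputable def holTriv : HolTriv ℂ L.fiber W where
  triv :=
    { toFun := h.toFun
      invFun := h.invFun
      source := π ℂ L.fiber ⁻¹' W
      target := (W : Set X) ×ˢ Set.univ
      map_source' := fun p hp => ⟨hp, trivial⟩
      map_target' := fun p hp => hp.1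
      left_inv' := by
        rintro ⟨x, v⟩ hx
        have hxx := mem_baseSet_trivializationAt ℂ L.fiber x
        simp only [toFun, invFun]
        rw [div_mul_cancel₀ _ (h.frame_ne_zero hx), Trivialization.symm_apply_apply_mk _ hxx]
      right_inv' := by
        rintro ⟨x, c⟩ ⟨hx, -⟩
        have hxx := mem_baseSet_trivializationAt ℂ L.fiber x
        simp only [toFun, invFun]
        rw [Trivialization.apply_mk_symm _ hxx, mul_div_cancel_right₀ _ (h.frame_ne_zero hx)]
      open_source := W.isOpen.preimage (FiberBundle.continuous_proj ℂ L.fiber)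
      open_target := W.isOpen.prod isOpen_univ
      continuousOn_toFun := h.contMDiffOn_toFun.continuousOn
      continuousOn_invFun := h.contMDiffOn_invFun.continuousOn
      baseSet := W
      open_baseSet := W.isOpen
      source_eq := rfl
      target_eq := rfl
      proj_toFun := fun _ _ => rfl }
  baseSet_eq := rfl
  linear := ⟨fun x _ => by
    have hlin := (trivializationAt ℂ L.fiber x).linear ℂ (mem_baseSet_trivializationAt ℂ L.fiber x)
    refine ⟨fun v v' => ?_, fun c v => ?_⟩
    · exact (congrArg (· / k x) (hlin.map_add v v')).trans (add_div _ _ _)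
    · exact (congrArg (· / k x) (hlin.map_smul c v)).trans (mul_div_assoc _ _ _)⟩
  hol := h.contMDiffOn_toFun
  hol_symm := h.contMDiffOn_invFun

theorem holTriv_apply {x : X} (v : L.fiber x) :
    (h.holTriv.triv ⟨x, v⟩).2 = (trivializationAt ℂ L.fiber x ⟨x, v⟩).2 / k x := rfl

end IsFrame

variable [IsManifold 𝓘(ℂ) ω X]

/-- Section and function have the same finite order `m`. After division by the `m`-th power of the
centred coordinate both are analytic and nonzero at `x`, and `q` is the quotient of these parts. -/
theorem exists_quotient {s : (x : X) → L.fiber x} (hs : IsMeromorphicSection ℂ s) {w : X → ℂ}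
    {φ : OpenPartialHomeomorph X ℂ} (hφ : φ ∈ IsManifold.maximalAtlas 𝓘(ℂ) ω X) {x : X}
    (hx : x ∈ φ.source) (hw : MeromorphicAt (w ∘ φ.symm) (φ x))
    (htop : meromorphicOrderAt (w ∘ φ.symm) (φ x) ≠ ⊤)
    (hord : sectionOrder ℂ s x = meromorphicOrderAt (w ∘ φ.symm) (φ x)) :
    ∃ q : X → ℂ, ContMDiffAt 𝓘(ℂ) 𝓘(ℂ) ω q x ∧ q x ≠ 0 ∧
      ∀ᶠ y in 𝓝[≠] x, w y ≠ 0 ∧ (trivializationAt ℂ L.fiber x ⟨y, s y⟩).2 = q y * w y := by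
  obtain ⟨ha, ha'⟩ := hs.meromorphicAt_localRep (HolTriv.at ℂ L.fiber x) hφ
    (mem_baseSet_trivializationAt ℂ L.fiber x) hx
  obtain ⟨m, hm⟩ := WithTop.ne_top_iff_exists.1 htop
  obtain ⟨g₁, hg₁, hg₁0, h₁⟩ := (meromorphicOrderAt_eq_int_iff ha).1 (ha'.trans (hord.trans hm.symm))
  obtain ⟨g₂, hg₂, hg₂0, h₂⟩ := (meromorphicOrderAt_eq_int_iff hw).1 hm.symm
  refine ⟨(g₁ / g₂) ∘ φ, (hg₁.div hg₂ hg₂0).contMDiffAt_comp_coord hφ hx,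
    div_ne_zero hg₁0 hg₂0, ?_⟩
  have hne : ∀ᶠ z in 𝓝[≠] (φ x), g₂ z ≠ 0 :=
    nhdsWithin_le_nhds (hg₂.continuousAt.eventually_ne hg₂0)
  filter_upwards [(tendsto_coord_nhdsNE φ hx).eventually h₁,
    (tendsto_coord_nhdsNE φ hx).eventually h₂, (tendsto_coord_nhdsNE φ hx).eventually hne,
    (tendsto_coord_nhdsNE φ hx).eventually self_mem_nhdsWithin,
    nhdsWithin_le_nhds (φ.open_source.mem_nhds hx)] with y h1 h2 h3 h4 h5
  have h6 : (φ y - φ x) ^ m ≠ 0 := zpow_ne_zero _ (sub_ne_zero.2 h4)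
  have h7 : w y = (φ y - φ x) ^ m * g₂ (φ y) := by
    simpa [φ.left_inv h5] using h2
  have h8 : (trivializationAt ℂ L.fiber x ⟨y, s y⟩).2 = (φ y - φ x) ^ m * g₁ (φ y) := by
    refine Eq.trans ?_ h1
    exact congrArg (fun y => (trivializationAt ℂ L.fiber x ⟨y, s y⟩).2) (φ.left_inv h5).symm
  refine ⟨by rw [h7]; exact mul_ne_zero h6 h3, ?_⟩
  rw [h8, h7, Function.comp_apply, Pi.div_apply]
  field_simp

/-- A meromorphic section of a line bundle, with the divisor of the meromorphic function `w` on the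
coordinate domain `W`, is given by `w` in some holomorphic trivialization over `W`. -/
theorem exists_holTriv [T1Space X] {s : (x : X) → L.fiber x} (hs : IsMeromorphicSection ℂ s)
    {w : X → ℂ} {φ : OpenPartialHomeomorph X ℂ} (hφ : φ ∈ IsManifold.maximalAtlas 𝓘(ℂ) ω X)
    {W : Opens X} (hW : φ.source = W) (hw : ∀ x ∈ W, MeromorphicAt (w ∘ φ.symm) (φ x))
    (htop : ∀ x ∈ W, meromorphicOrderAt (w ∘ φ.symm) (φ x) ≠ ⊤)
    (hord : ∀ x ∈ W, sectionOrder ℂ s x = meromorphicOrderAt (w ∘ φ.symm) (φ x)) :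
    ∃ t : HolTriv ℂ L.fiber W, ∀ x ∈ W, ∀ᶠ y in 𝓝[≠] x, (t.triv ⟨y, s y⟩).2 = w y := by
  have hWφ : ∀ x ∈ W, x ∈ φ.source := fun x hx => by rw [hW]; exact hx
  choose! q hq hq0 hqw using fun x hx =>
    exists_quotient hs hφ (hWφ x hx) (hw x hx) (htop x hx) (hord x hx)
  -- The frame is the extension of `s / w`. Its value at `y` is taken from the local quotient `q y`
  -- centred at `y`, so the different local quotients must be shown to agree.
  have h : IsFrame L W (fun y => q y y) q := by
    refine ⟨hq, hq0, fun x hx => ?_⟩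
    have h1 : ∀ᶠ y in 𝓝 x, ContMDiffAt 𝓘(ℂ) 𝓘(ℂ) ω (q x) y := 
      (contMDiffAt_iff_contMDiffAt_nhds (by simp)).1 (hq x hx)
    have h2 := eventually_nhdsWithin_iff.1 (eventually_nhdsNE_eventually_nhds_iff.2 (hqw x hx))
    filter_upwards [h1, h2, W.isOpen.mem_nhds hx,
      (trivializationAt ℂ L.fiber x).open_baseSet.mem_nhds
        (mem_baseSet_trivializationAt ℂ L.fiber x)] with y hy1 hy2 hyW hyB
    have hyy := mem_baseSet_trivializationAt ℂ L.fiber y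
    have h3 : ∀ᶠ z in 𝓝[≠] y, w z ≠ 0 ∧ (trivializationAt ℂ L.fiber x ⟨z, s z⟩).2 = q x z * w z := by
      rcases eq_or_ne y x with rfl | hne
      · exact hqw y hx
      · exact (hy2 hne).filter_mono nhdsWithin_le_nhds
    have hBo := ((trivializationAt ℂ L.fiber x).open_baseSet.inter
      (trivializationAt ℂ L.fiber y).open_baseSet).mem_nhds ⟨hyB, hyy⟩
    -- Near `y`, off `y`, both candidates times `w` express `s` in the trivialization at `x`.
    -- Cancelling `w` and passing to the limit gives equality at `y` itself, where `w` may have a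
    -- zero or pole.
    refine eq_of_eventually_nhdsNE_eq (g := fun z => L.preferred.transition x y z * q y z)
      hy1.continuousAt (ContinuousAt.mul ?_ (hq y hyW).continuousAt) ?_
    · exact (L.preferred.holOn_transition x y).continuousOn.continuousAt hBo
    · filter_upwards [h3, hqw y hyW, nhdsWithin_le_nhds hBo] with z hz1 hz2 hz3
      have h4 : (trivializationAt ℂ L.fiber x ⟨z, s z⟩).2 =
        L.preferred.transition x y z * (trivializationAt ℂ L.fiber y ⟨z, s z⟩).2 :=
        L.preferred.transition_mul x y hz3.1 hz3.2 (s z)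
      rw [hz1.2, hz2.2, ← mul_assoc] at h4
      exact mul_right_cancel₀ hz1.1 h4
  refine ⟨h.holTriv, fun x hx => ?_⟩
  filter_upwards [hqw x hx, nhdsWithin_le_nhds (h.eventually_coord hx)] with y hy1 hy2
  rw [h.holTriv_apply, IsFrame.div_eq_div hy2.2.1 hy2.2.2.2, hy1.2,
    mul_div_cancel_left₀ _ hy2.2.2.1]

end Trivialize

/-! ### The first Chern class -/

section ChernClass

variable {X : Type u} [TopologicalSpace X] [ChartedSpace ℂ X] {ι : Type w} {U : ι → Opens X}

theorem dlogCocycle_congr {L : HolLineBundle.{u, v} X} {L' : HolLineBundle.{u, y} X}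
    {t : LineTriv L U} {t' : LineTriv L' U}
    (h : ∀ i j, ∀ x ∈ U i ⊓ U j, t.transition i j x = t'.transition i j x) :
    t.dlogCocycle = t'.dlogCocycle := by
  apply Subtype.ext
  funext i j
  apply Subtype.ext
  funext x
  exact dlog_congr (by filter_upwards [(U i ⊓ U j).isOpen.mem_nhds x.2] with y hy using h i j y hy)

variable {L : HolLineBundle.{u, v} X}

theorem LineTriv.dlog_transition_trans (t : LineTriv L U) (i j k : ι) {x : X} (hi : x ∈ U i)
    (hj : x ∈ U j) (hk : x ∈ U k) :
    dlog (t.transition i k) x = dlog (t.transition i j) x + dlog (t.transition j k) x := by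
  rw [← dlog_mul ((t.holOn_transition i j).mdifferentiableAt (W := U i ⊓ U j) ⟨hi, hj⟩)
    ((t.holOn_transition j k).mdifferentiableAt (W := U j ⊓ U k) ⟨hj, hk⟩)
    (t.transition_ne_zero i j hi hj) (t.transition_ne_zero j k hj hk)]
  apply dlog_congr
  filter_upwards [(U i ⊓ U j ⊓ U k).isOpen.mem_nhds ⟨⟨hi, hj⟩, hk⟩] with y hy
  exact t.transition_trans i j k hy.1.1 hy.1.2 hy.2

/-- The two families of trivializations, taken together. -/
def LineTriv.sum (t t' : LineTriv L U) : LineTriv L (Sum.elim U U)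
  | Sum.inl i => t i
  | Sum.inr i => t' i

/-- If `h_i` is the transition function between the two trivializations over `U_i`, then `h_i g'_ij
= g_ij h_j`, so the two cocycles differ by the coboundary of `d log h_i` up to sign. Joining both
families into one makes `h_i` an ordinary transition function. -/
theorem LineTriv.chernClass_eq (t t' : LineTriv L U) : t.chernClass = t'.chernClass := by
  set T := t.sum t' with hT
  have hη : ∀ i, (fun x : U i => dlog (T.transition (Sum.inl i) (Sum.inr i)) (x : X)) ∈
      Omega (U i) := fun i => dlog_mem_Omega
    ((T.holOn_transition (Sum.inl i) (Sum.inr i)).mono fun x hx => ⟨hx, hx⟩)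
    fun x hx => T.transition_ne_zero (Sum.inl i) (Sum.inr i) hx hx
  refine (Submodule.Quotient.eq _).2 ?_
  rw [Submodule.submoduleOf, Submodule.mem_comap]
  -- The sign comes from the convention `(δη)_ij = η_j - η_i`.
  refine ⟨fun i => -⟨_, hη i⟩, ?_⟩
  funext i j
  apply Subtype.ext
  funext x
  have hi : (x : X) ∈ U i := x.2.1
  have hj : (x : X) ∈ U j := x.2.2
  have h1 := T.dlog_transition_trans (Sum.inl i) (Sum.inl j) (Sum.inr j) hi hj hj
  have h2 := T.dlog_transition_trans (Sum.inl i) (Sum.inr i) (Sum.inr j) hi hi hj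
  show -dlog (T.transition (Sum.inl j) (Sum.inr j)) (x : X) -
    -dlog (T.transition (Sum.inl i) (Sum.inr i)) (x : X) =
    dlog (T.transition (Sum.inl i) (Sum.inl j)) (x : X) -
    dlog (T.transition (Sum.inr i) (Sum.inr j)) (x : X)
  rw [h1] at h2
  rw [eq_sub_of_add_eq h2]
  abel

theorem dlog_comp_coord {φ : OpenPartialHomeomorph X ℂ}
    (hφ : φ ∈ IsManifold.maximalAtlas 𝓘(ℂ) ω X) {x : X} (hx : x ∈ φ.source) {g p : ℂ → ℂ}
    (hg : DifferentiableAt ℂ g (φ x)) (hg0 : g (φ x) ≠ 0)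
    (hp : deriv g (φ x) = p (φ x) * g (φ x)) :
    dlog (fun y => g (φ y)) x = coordForm φ p x := by
  have h1 : MDifferentiableAt 𝓘(ℂ) 𝓘(ℂ) φ x := (contMDiffAt_coord hφ hx).mdifferentiableAt (by simp)
  have h2 : diff (fun y => g (φ y)) x = deriv g (φ x) • diff φ x := by
    rw [diff, show (fun y => g (φ y)) = g ∘ φ from rfl,
      mfderiv_comp (I' := 𝓘(ℂ)) x hg.mdifferentiableAt h1]
    refine ContinuousLinearMap.ext (M₁ := TangentSpace 𝓘(ℂ) x) fun v => ?_
    rw [mfderiv_eq_fderiv]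
    exact (fderiv_eq_smul_deriv (𝕜 := ℂ) (f := g) _).trans (mul_comm _ _)
  rw [dlog, h2, coordForm, smul_smul, hp, mul_comm, mul_assoc, mul_inv_cancel₀ hg0, mul_one]

theorem eventually_codiscreteWithin {Y : Type*} [TopologicalSpace Y] {S : Set Y} {p : Y → Prop}
    (h : ∀ x ∈ S, ∀ᶠ y in 𝓝[≠] x, y ∈ S → p y) : ∀ᶠ y in Filter.codiscreteWithin S, p y := by
  rw [Filter.Eventually, mem_codiscreteWithin_iff_forall_mem_nhdsNE]
  intro x hx
  filter_upwards [h x hx] with y hy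
  by_cases hyS : y ∈ S
  · exact Or.inl (hy hyS)
  · exact Or.inr hyS

end ChernClass

/-! ### Transition functions of the Wronskian line bundle and their logarithmic differentials. -/

section WronskianLineBundle

variable {X : Type u} [TopologicalSpace X] [ChartedSpace ℂ X] [IsManifold 𝓘(ℂ) ω X] {n : ℕ}
  {V : X → Type v} [TopologicalSpace (TotalSpace (Fin n → ℂ) V)]
  [∀ x, TopologicalSpace (V x)] [∀ x, AddCommGroup (V x)] [∀ x, Module ℂ (V x)]
  [FiberBundle (Fin n → ℂ) V] [VectorBundle ℂ (Fin n → ℂ) V]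
  [ContMDiffVectorBundle ω (Fin n → ℂ) V 𝓘(ℂ)] {ι ι₀ : Type*} {P : PFTriv (n := n) V ι}
  {P₀ : PFTriv (n := n) V ι₀} {A : (x : X) → V x}

namespace PFTriv

/-- The section `B` hidden in the definition may differ from the given `A`. Frames in which `s`
reads `w(B_i)` have transition functions `w(B_i) / w(B_j)`, and `factor` is the same for all
sections. -/
theorem IsWronskianLineBundle.exists_lineTriv [T1Space X] [PreconnectedSpace X]
    {L : HolLineBundle.{u, y} X} (hL : P₀.IsWronskianLineBundle L) (hP : P.Compatible P₀) :
    ∃ t : LineTriv L P.U, ∀ i j, ∀ x ∈ P.U i ⊓ P.U j, t.transition i j x = P.factor i j x := by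
  obtain ⟨B, hB, hgen, s, hs, hord⟩ := hL
  have hne : ∀ i, ∀ x ∈ P.U i, P.wrOrder B i x ≠ ⊤ := fun i x hx =>
    hgen.wrOrder_ne_top_of_compatible hB hP hx
  have h := fun i => exists_holTriv hs (P.coord_mem i) (P.coord_source i)
    (w := fun y => P.wr B i (P.coord i y)) (fun x hx => meromorphicAt_wr_comp_symm hB hx)
    (fun x hx => by rw [← wrOrder_eq_comp hx]; exact hne i x hx)
    (fun x hx => by
      obtain ⟨j, hj⟩ := P₀.covers x
      rw [← wrOrder_eq_comp hx, wrOrder_eq hB hP hx hj, hord j x hj])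
  choose t ht using h
  refine ⟨t, fun i j x hx => ?_⟩
  refine eq_of_eventually_nhdsNE_eq
    ((LineTriv.holOn_transition (L := L) (U := P.U) t i j).continuousOn.continuousAt
      ((P.U i ⊓ P.U j).isOpen.mem_nhds hx))
    (P.contMDiffAt_factor hx).continuousAt ?_
  filter_upwards [ht i x hx.1, ht j x hx.2, eventually_wr_eq_factor_mul hB hx,
    (wrOrder_ne_top_iff hB hx.2).1 (hne j x hx.2),
    nhdsWithin_le_nhds ((P.U i ⊓ P.U j).isOpen.mem_nhds hx)] with y h1 h2 h3 h4 h5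
  have h6 := LineTriv.transition_mul (L := L) (U := P.U) t i j h5.1 h5.2 (s y)
  rw [h1, h2, h3] at h6
  exact (mul_right_cancel₀ h4 h6).symm

theorem eventually_dlog_wr [NeZero n] (hA : IsMeromorphicSection (Fin n → ℂ) A) {i : ι} {x : X}
    (hx : x ∈ P.U i) (hne : P.wrOrder A i x ≠ ⊤) {p : Fin n → ℂ → ℂ}
    (hp : IsODE (P.rep A i) (P.coord i).target p) :
    ∀ᶠ y in 𝓝[≠] x, dlog (fun y => P.wr A i (P.coord i y)) y = coordForm (P.coord i) (p 0) y := by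
  have hxφ := P.mem_source hx
  have hode := mem_codiscreteWithin_iff_forall_mem_nhdsNE.1 hp.2 _ ((P.coord i).map_source hxφ)
  filter_upwards [eventually_analyticAt_rep hA hx, (wrOrder_ne_top_iff hA hx).1 hne,
    (tendsto_coord_nhdsNE _ hxφ).eventually hode,
    nhdsWithin_le_nhds ((P.coord i).open_source.mem_nhds hxφ)] with y h1 h2 h3 h4
  have h5 : iteratedDeriv n (P.rep A i) (P.coord i y) =
      ∑ k : Fin n, p k (P.coord i y) • iteratedDeriv (n - 1 - k) (P.rep A i) (P.coord i y) :=
    h3.resolve_right fun h => h ((P.coord i).map_source h4)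
  exact dlog_comp_coord (P.coord_mem i) h4 (analyticAt_wronskian h1).differentiableAt h2
    (deriv_wronskian h1 (p := fun k => p k (P.coord i y)) h5)

theorem eventually_dlog_factor [NeZero n] (hA : IsMeromorphicSection (Fin n → ℂ) A) {i j : ι}
    {x : X} (hx : x ∈ P.U i ⊓ P.U j) (hne : ∀ i, ∀ x ∈ P.U i, P.wrOrder A i x ≠ ⊤)
    {p : ι → Fin n → ℂ → ℂ} (hp : ∀ i, IsODE (P.rep A i) (P.coord i).target (p i)) :
    ∀ᶠ y in 𝓝[≠] x, dlog (P.factor i j) y =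
      coordForm (P.coord i) (p i 0) y - coordForm (P.coord j) (p j 0) y := by
  filter_upwards [eventually_dlog_wr hA hx.1 (hne i x hx.1) (hp i),
    eventually_dlog_wr hA hx.2 (hne j x hx.2) (hp j), eventually_analyticAt_rep hA hx.1,
    (wrOrder_ne_top_iff hA hx.2).1 (hne j x hx.2),
    nhdsWithin_le_nhds ((P.U i ⊓ P.U j).isOpen.mem_nhds hx)] with y h1 h2 h3 h4 h5
  -- The relation is needed on a full neighbourhood of `y` in order to be differentiated; it holds
  -- there because `A_i` is analytic at `y`.
  have h6 : (fun y => P.wr A i (P.coord i y)) =ᶠ[𝓝 y]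
      fun y => P.factor i j y * P.wr A j (P.coord j y) := by
    filter_upwards [((P.coord i).continuousAt (P.mem_source h5.1)).eventually
      h3.eventually_analyticAt, (P.U i ⊓ P.U j).isOpen.mem_nhds h5] with z hz hz'
    exact wr_eq_factor_mul hz' hz
  have h7 : ContMDiffAt 𝓘(ℂ) 𝓘(ℂ) ω (fun y => P.wr A j (P.coord j y)) y :=
    (analyticAt_wronskian (analyticAt_rep h5.2 h5.1 h3)).contMDiffAt_comp_coord (P.coord_mem j)
      (P.mem_source h5.2)
  rw [← h1, ← h2, dlog_congr h6, dlog_mul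
    ((P.contMDiffAt_factor h5).mdifferentiableAt (by simp)) (h7.mdifferentiableAt (by simp))
    (P.factor_ne_zero h5) h4, add_sub_cancel_right]

end PFTriv

end WronskianLineBundle

end Wronskian

/-! ### The main theorem. -/

open Wronskian Wronskian.PFTriv in
theorem mainTheorem2 {X : Type u} [TopologicalSpace X] [T2Space X] [ConnectedSpace X]
    [ChartedSpace ℂ X] [IsManifold 𝓘(ℂ) ω X] {n : ℕ} [NeZero n]
    -- a holomorphic vector bundle of rank `n` with a projectively flat structure `P₀`
    (V : X → Type v) [TopologicalSpace (TotalSpace (Fin n → ℂ) V)]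
    [∀ x, TopologicalSpace (V x)] [∀ x, AddCommGroup (V x)] [∀ x, Module ℂ (V x)]
    [FiberBundle (Fin n → ℂ) V] [VectorBundle ℂ (Fin n → ℂ) V]
    [ContMDiffVectorBundle ω (Fin n → ℂ) V 𝓘(ℂ)]
    {ι₀ : Type*} (P₀ : Wronskian.PFTriv (n := n) V ι₀)
    -- a generic meromorphic section
    (A : (x : X) → V x) (hA : Wronskian.IsMeromorphicSection (Fin n → ℂ) A)
    (hgen : P₀.IsGeneric A)
    -- a projectively flat trivialization such that `w(A)` has no zeros or poles on overlaps
    {ι : Type w} (P : Wronskian.PFTriv (n := n) V ι) (hP : P.Compatible P₀)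
    (hover : ∀ i j, i ≠ j → ∀ x ∈ P.U i ⊓ P.U j, P.wrOrder A i x = 0) :
    -- the Wronskian line bundle exists
    (∃ L : Wronskian.HolLineBundle.{u, 0} X, P₀.IsWronskianLineBundle L) ∧
    -- each `A_i` satisfies an ordinary differential equation
    (∀ i, ∃ p, Wronskian.IsODE (P.rep A i) (P.coord i).target p) ∧
    -- the quotients `λ_ij = w(A_i) / w(A_j)` are holomorphic without zeros, and form a cocycle
    ∃ lam : ι → ι → X → ℂ,
      (∀ i j, Wronskian.HolOn (lam i j) ((P.U i ⊓ P.U j : Opens X) : Set X) ∧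
        (∀ x ∈ P.U i ⊓ P.U j, lam i j x ≠ 0) ∧
        ∀ᶠ x in Filter.codiscreteWithin ((P.U i ⊓ P.U j : Opens X) : Set X),
          lam i j x = P.wr A i (P.coord i x) / P.wr A j (P.coord j x)) ∧
      (∀ i j k, ∀ x ∈ P.U i ⊓ P.U j ⊓ P.U k, lam i j x * lam j k x = lam i k x) ∧
      -- they are the transition functions of `w(V)`
      (∀ L : Wronskian.HolLineBundle.{u, y} X, P₀.IsWronskianLineBundle L →
        ∃ t : Wronskian.LineTriv L P.U, ∀ i j, ∀ x ∈ P.U i ⊓ P.U j,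
          t.transition i j x = lam i j x) ∧
      -- `d log λ_ij = p_1^i dz_i - p_1^j dz_j` is a cocycle with class `c_1(w(V))`
      ∀ p : ι → Fin n → ℂ → ℂ,
        (∀ i, Wronskian.IsODE (P.rep A i) (P.coord i).target (p i)) →
        ∃ c : Wronskian.Z1 P.U,
          (∀ i j, ∀ x : (P.U i ⊓ P.U j : Opens X),
            (c.1 i j).1 x = Wronskian.dlog (lam i j) x) ∧
          (∀ i j, ∀ᶠ x in Filter.codiscreteWithin ((P.U i ⊓ P.U j : Opens X) : Set X),
            ∀ hx : x ∈ P.U i ⊓ P.U j, (c.1 i j).1 ⟨x, hx⟩ =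
              Wronskian.coordForm (P.coord i) (p i 0) x -
              Wronskian.coordForm (P.coord j) (p j 0) x) ∧
          ∀ L : Wronskian.HolLineBundle.{u, y} X, P₀.IsWronskianLineBundle L →
            ∀ t : Wronskian.LineTriv L P.U,
              t.chernClass = Wronskian.cls P.U c := by

  have hne : ∀ i, ∀ x ∈ P.U i, P.wrOrder A i x ≠ ⊤ := fun i x hx =>
    hgen.wrOrder_ne_top_of_compatible hA hP hx
  refine ⟨exists_isWronskianLineBundle hA hgen, fun i => ?_, P.factor, fun i j =>
    ⟨P.holOn_factor i j, fun x hx => P.factor_ne_zero hx, ?_⟩,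
    (isHolCocycle_factor hA hne).mul, fun L hL => hL.exists_lineTriv hP, fun p hp => ?_⟩
  · have hx : ∀ z ∈ (P.coord i).target, ∃ x ∈ P.U i, P.coord i x = z := fun z hz =>
      ⟨(P.coord i).symm z, by
        have := (P.coord i).map_target hz
        rwa [P.coord_source] at this, (P.coord i).right_inv hz⟩
    refine exists_isODE (fun z hz => ?_) fun z hz => ?_
    · obtain ⟨x, hx, rfl⟩ := hx z hz
      exact meromorphicAt_rep hA hx
    · obtain ⟨x, hx, rfl⟩ := hx z hz
      exact hne i x hx
  · refine eventually_codiscreteWithin fun x hx => ?_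
    filter_upwards [eventually_wr_eq_factor_mul hA hx,
      (wrOrder_ne_top_iff hA hx.2).1 (hne j x hx.2)] with y h1 h2 _
    rw [h1, mul_div_cancel_right₀ _ h2]
  -- The cocycle is borrowed from one Wronskian line bundle `L₀`, trivialized with transition
  -- functions `λ_ij`; the cocycle condition and holomorphy of its forms come with it.
  · obtain ⟨L₀, hL₀⟩ := exists_isWronskianLineBundle hA hgen
    obtain ⟨t₀, ht₀⟩ := hL₀.exists_lineTriv hP
    have hc : ∀ i j, ∀ x : (P.U i ⊓ P.U j : Opens X),
        (t₀.dlogCocycle.1 i j).1 x = dlog (P.factor i j) x := fun i j x => dlog_congr (by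
      filter_upwards [(P.U i ⊓ P.U j).isOpen.mem_nhds x.2] with y hy using ht₀ i j y hy)
    refine ⟨t₀.dlogCocycle, hc, fun i j => ?_, fun L hL t => ?_⟩
    · refine eventually_codiscreteWithin fun x hx => ?_
      filter_upwards [eventually_dlog_factor hA hx hne hp] with y hy _ hyU
      rw [hc, hy]
    -- The arbitrary `t` is replaced by a trivialization of the same `L` with transition functions
    -- `λ_ij`. The cocycle of the latter equals that of `t₀`, although `L` and `L₀` are different
    -- bundles.
    · obtain ⟨t₁, ht₁⟩ := hL.exists_lineTriv hP
      rw [t.chernClass_eq t₁, LineTriv.chernClass, dlogCocycle_congr (t' := t₀) fun i j x hx =>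
        (ht₁ i j x hx).trans (ht₀ i j x hx).symm]
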